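/- **Conventions.** A *word* over a finite alphabet $\Sigma$ is a map from a finite subset of $\mathbb Z$ to $\Sigma$. The *convolution* $\mathrm{conv}(v,w)$ of two words is the word with domain $\mathrm{dom}(v)\cup\mathrm{dom}(w)$ that maps $k$ to the pair of the values of $v$ and $w$ at $k$, an undefined value being replaced by a filling symbol $\#$; similarly for three words. A set of words is *regular* if a finite automaton recognises it, where the automaton reads a word from left to right on an interval of positions that contains $0$ and the domain of the word, sees $\#$ at positions outside the domain, and sees which position is position $0$. A relation is *automatic* if the set of convolutions of its tuples is regular. A family $\{L_d : d\in D\}$ of sets of words, indexed by a set $D$ of words over some finite alphabet, is an *automatic family* if $D$ and $\{\mathrm{conv}(d,x) : d\in D,\ x\in L_d\}$ are regular. A *semiautomatic grid* is a dense subring $G$ of $\mathbb R$ together with a regular set of words over a finite alphabet that represent the elements of $G$ (each element by at least one, possibly by several words), such that, on representatives, the relations $x+y=z$, $x=y$ and $x<y$ are automatic and, for each fixed $a\in G$, the relations $a\cdot x=y$ and $x\cdot a=y$ are automatic. A point $(x,y)\in G\times G$ is represented by the words $\mathrm{conv}(v,w)$, where $v$ represents $x$ and $w$ represents $y$; a subset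 $P$ of the plane is identified with the set of all words that represent points of $P\cap(G\times G)$. Triangles are closed, filled and nondegenerate. **Theorem.** Let $G$ be any semiautomatic grid. 1. The family of all triangles is not an automatic family: there is no automatic family $\{L_d : d\in D\}$ such that every $L_d$ is the set $T\cap(G\times G)$ for some triangle $T\subset\mathbb R^2$, and such that for every triangle $T$ with corners in $G\times G$ the set $T\cap(G\times G)$ is one of the $L_d$. (In particular, the family of all triangles with corners in $G\times G$ is not automatic.) 2. Every single triangle with corners in $G\times G$ is a regular set. 3. Every polygon with corners in $G\times G$ is a regular set. Here the polygon with corners $p_1,\dots,p_n$ is the closed region consisting of the closed polygonal line $p_1p_2\cdots p_np_1$ and of all points enclosed by it, i.e. lying in a bounded connected component of its complement in $\mathbb R^2$ (the polygonal line is not required to be simple). -/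

import Mathlib

/-- A word over the alphabet `A`: a map from a finite subset of `ℤ` to `A`
(the value `none` means that the position is outside the domain). -/
structure Word (A : Type*) where
  /-- The symbol at a position, or `none` outside the domain. -/
  symbol : ℤ → Option A
  /-- The domain is finite. -/
  finite_domain : {k : ℤ | symbol k ≠ none}.Finite

namespace Word

variable {A B C : Type*}

/-- The domain of a word. -/
def domain (w : Word A) : Set ℤ := {k | w.symbol k ≠ none}

/-- What an automaton sees when it reads `w` on the window `-m, …, n`: the list of the symbols
from position `-m` to position `n`, where `none` plays the role of the filling symbol `#`.
The `Bool` component marks position `0`, so that words are read together with their alignment. -/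
def reading (w : Word A) (m n : ℕ) : List (Bool × Option A) :=
  (List.range (m + n + 1)).map fun i : ℕ =>
    (decide ((i : ℤ) - m = 0), w.symbol ((i : ℤ) - m))

/-- The convolution of two words: its domain is the union of the domains, and a position where only
one of the words is defined is filled with `#` (that is, `none`) in the other component. -/
def conv (v : Word A) (w : Word B) : Word (Option A × Option B) where
  symbol k :=
    if v.symbol k = none ∧ w.symbol k = none then none else some (v.symbol k, w.symbol k)
  finite_domain := by
    refine (v.finite_domain.union w.finite_domain).subset fun k hk => ?_
    by_contra h
    simp only [Set.mem_union, Set.mem_ofPred_eq, not_or, not_not] at h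
    simp [h.1, h.2] at hk

/-- The convolution of three words. -/
def conv₃ (u : Word A) (v : Word B) (w : Word C) : Word (Option A × Option B × Option C) where
  symbol k :=
    if u.symbol k = none ∧ v.symbol k = none ∧ w.symbol k = none then none
    else some (u.symbol k, v.symbol k, w.symbol k)
  finite_domain := by
    refine ((u.finite_domain.union v.finite_domain).union w.finite_domain).subset fun k hk => ?_
    by_contra h
    simp only [Set.mem_union, Set.mem_ofPred_eq, not_or, not_not] at h
    simp [h.1.1, h.1.2, h.2] at hk

end Word

/-- A set of words is regular if the language of all readings of its members, on all windows
that contain the domain, is recognised by a deterministic finite automaton. -/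
def IsRegularSet {A : Type*} (L : Set (Word A)) : Prop :=
  Language.IsRegular
    ({u | ∃ w ∈ L, ∃ m n : ℕ, w.domain ⊆ Set.Icc (-(m : ℤ)) (n : ℤ) ∧ u = w.reading m n} :
      Language (Bool × Option A))

/-- A binary relation on words is automatic if the set of convolutions of its pairs is regular. -/
def IsAutomaticRel₂ {A B : Type*} (R : Word A → Word B → Prop) : Prop :=
  IsRegularSet {u | ∃ x y, R x y ∧ u = Word.conv x y}

/-- A ternary relation on words is automatic if the set of convolutions of its triples is
regular. -/
def IsAutomaticRel₃ {A B C : Type*} (R : Word A → Word B → Word C → Prop) : Prop :=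
  IsRegularSet {u | ∃ x y z, R x y z ∧ u = Word.conv₃ x y z}

/-- The sets `L d` with `d ∈ D` form an automatic family: the index set `D` and the set of all
convolutions of `d` and `x` with `d ∈ D` and `x ∈ L d` are regular. -/
def IsAutomaticFamily {A B : Type*} (D : Set (Word A)) (L : Word A → Set (Word B)) : Prop :=
  IsRegularSet D ∧ IsAutomaticRel₂ fun d x => d ∈ D ∧ x ∈ L d

/-- A semiautomatic grid `(A, +, =, <; ·)` over the alphabet `S`: a regular set of words that
represents (possibly with several words for the same number) a dense subring of the reals, such
that addition, equality and comparison are automatic and multiplication is semiautomatic,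
i.e. multiplication with any fixed element is automatic. -/
structure SemiautomaticGrid (S : Type*) where
  /-- The alphabet is finite. -/
  finite_alphabet : Finite S
  /-- The set of words that represent numbers. -/
  words : Set (Word S)
  /-- The number represented by a word (only used for members of `words`). -/
  val : Word S → ℝ
  /-- The ring of represented numbers. -/
  ring : Subring ℝ
  image_val : val '' words = (ring : Set ℝ)
  dense_ring : ∀ p r : ℝ, p < r → ∃ q ∈ ring, p < q ∧ q < r
  regular_words : IsRegularSet words
  automatic_eq : IsAutomaticRel₂ fun x y => x ∈ words ∧ y ∈ words ∧ val x = val y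
  automatic_lt : IsAutomaticRel₂ fun x y => x ∈ words ∧ y ∈ words ∧ val x < val y
  automatic_add : IsAutomaticRel₃ fun x y z =>
    x ∈ words ∧ y ∈ words ∧ z ∈ words ∧ val x + val y = val z
  semiautomatic_mul_left : ∀ a ∈ words, IsAutomaticRel₂ fun x y =>
    x ∈ words ∧ y ∈ words ∧ val a * val x = val y
  semiautomatic_mul_right : ∀ a ∈ words, IsAutomaticRel₂ fun x y =>
    x ∈ words ∧ y ∈ words ∧ val x * val a = val y

namespace SemiautomaticGrid

variable {S : Type*}

/-- The plane `G × G`, as a subset of the real plane. -/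
def plane (G : SemiautomaticGrid S) : Set (ℝ × ℝ) := (G.ring : Set ℝ) ×ˢ (G.ring : Set ℝ)

/-- The part of a subset `P` of the real plane that lies in `G × G`, as a set of words: a point
is represented by the convolutions of the words representing its two coordinates. -/
def trace (G : SemiautomaticGrid S) (P : Set (ℝ × ℝ)) : Set (Word (Option S × Option S)) :=
  {u | ∃ x ∈ G.words, ∃ y ∈ G.words, (G.val x, G.val y) ∈ P ∧ u = Word.conv x y}

end SemiautomaticGrid

/-- The closed (filled) triangle with given affinely independent corners. -/
def triangleRegion (T : Affine.Triangle ℝ (ℝ × ℝ)) : Set (ℝ × ℝ) :=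
  convexHull ℝ (Set.range T.points)

/-- The closed region of a polygon: the boundary together with all points that it encloses, i.e.
whose connected component in the complement of the boundary is bounded. -/
def polygonRegion {n : ℕ} (P : Polygon (ℝ × ℝ) n) : Set (ℝ × ℝ) :=
  P.boundary ℝ ∪
    {x | x ∉ P.boundary ℝ ∧ Bornology.IsBounded (connectedComponentIn (P.boundary ℝ)ᶜ x)}

/-!
Automata enter only through closure properties. A predicate on words, or on tuples of words, is
called recognizable if a regular language decides it on all windows containing the domain. Such
predicates are closed under Boolean operations, under letterwise preimages and under quantification
over words (`Recognizable.exists`), and `x = c` is recognizable for every fixed `c`. Regular sets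
and automatic relations are recognizable predicates (`isRegularSet_iff_recognizable`,
`isAutomaticRel₂_iff_recognizable`), so everything first-order definable from the grid operations,
multiplication by constants and constants is regular.

*Triangles and polygons.* Since multiplication with fixed elements is automatic, half-planes
bounded by lines with coefficients in the grid are regular, and so is every union of cells of an
arrangement of finitely many such lines (`SemiautomaticGrid.isRegularSet_trace_of_sign`). A triangle
is such a union for the lines through its sides. For a polygon, the lines through the edges and the
vertical and horizontal lines through the vertices are taken: the boundary is a union of cells, and
all other cells are convex, thus connected, and so each of them lies in a single connected component
of the complement of the boundary.

*The family of all triangles.* If it were automatic, an index `d` would give access to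
multiplication by the slope of an upper edge of `L d`: the upper boundary `f` of `L d` is an
automatic function of `d` and the abscissa. For every window there is a triangle with corners in
the grid such that `(a, b) ↦ f a + b` is injective on the set `V n` of numbers with words in the
window `-n, …, n`: its upper edge is long enough to lie above `V n` and so steep that its slope
differs from the finitely many quotients that would give a collision. This property of `d` is
recognizable. Witnesses of recognizable relations need only boundedly many letters more than the
given words (`Recognizable.exists_short_witness`), so `d`, `f a` and `f a + b` have words in the
window `-(n + K), …, n + K` with `K` independent of `n`. Hence `|V n| ^ 2 ≤ |V (n + K)|`, and `|V n|`
grows doubly exponentially (`SemiautomaticGrid.exists_windowValues_ncard_sq_le`), while the number of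
words in a window is only exponential.
-/

universe u v w

/-! ### Words and their readings -/

/-- Types whose elements are words in the broad sense: maps from `ℤ` to a finite set of letters
that are blank at all but finitely many positions. Tuples of words are again of this kind, which is
why relations between words can be handled in the same way as sets of words. -/
class WordLike (X : Type u) where
  /-- The letters. -/
  Letter : Type u
  finite_letter : Finite Letter
  /-- The letter at the positions outside the domain. -/
  blank : Letter
  /-- The letter at a position. -/
  symb : X → ℤ → Letter
  finite_support : ∀ x, {k | symb x k ≠ blank}.Finite
  symb_injective : Function.Injective symb
  exists_symb_eq : ∀ f : ℤ → Letter, {k | f k ≠ blank}.Finite → ∃ x, symb x = f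

namespace WordLike

attribute [instance] WordLike.finite_letter

section Instances

instance {A : Type u} [Finite A] : WordLike (Word A) where
  Letter := Option A
  finite_letter := inferInstance
  blank := none
  symb := Word.symbol
  finite_support := Word.finite_domain
  symb_injective := by
    rintro ⟨f, hf⟩ ⟨g, hg⟩ h
    simpa using h
  exists_symb_eq f hf := ⟨⟨f, hf⟩, rfl⟩

instance {X : Type u} {Y : Type v} [WordLike X] [WordLike Y] : WordLike (X × Y) where
  Letter := Letter X × Letter Y
  finite_letter := inferInstance
  blank := (blank, blank)
  symb x k := (symb x.1 k, symb x.2 k)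
  finite_support x := by
    refine ((finite_support x.1).union (finite_support x.2)).subset fun k hk => ?_
    by_contra h
    simp only [Set.mem_union, Set.mem_ofPred_eq, not_or, not_not] at h
    simp [h.1, h.2] at hk
  symb_injective x y h := by
    refine Prod.ext (symb_injective ?_) (symb_injective ?_)
    · funext k; exact congrArg Prod.fst (congrFun h k)
    · funext k; exact congrArg Prod.snd (congrFun h k)
  exists_symb_eq f hf := by
    obtain ⟨x, hx⟩ := exists_symb_eq (X := X) (fun k => (f k).1)
      (hf.subset fun k hk h => hk (congrArg Prod.fst h))
    obtain ⟨y, hy⟩ := exists_symb_eq (X := Y) (fun k => (f k).2)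
      (hf.subset fun k hk h => hk (congrArg Prod.snd h))
    exact ⟨(x, y), funext fun k => Prod.ext (congrFun hx k) (congrFun hy k)⟩

end Instances

variable {X : Type u} {Y : Type v} {Z : Type w} [WordLike X] [WordLike Y] [WordLike Z]

/-- All letters of `x` outside the window `-m, …, n` are blank. -/
def FitsIn (x : X) (m n : ℕ) : Prop :=
  ∀ k : ℤ, symb x k ≠ blank → -(m : ℤ) ≤ k ∧ k ≤ n

theorem FitsIn.mono {x : X} {m n m' n' : ℕ} (h : FitsIn x m n) (hm : m ≤ m') (hn : n ≤ n') :
    FitsIn x m' n' := fun k hk => by have := h k hk; omega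

theorem exists_fitsIn (x : X) : ∃ n, FitsIn x n n := by
  obtain ⟨b, hb⟩ := ((finite_support x).image Int.natAbs).bddAbove
  refine ⟨b, fun k hk => ?_⟩
  have : k.natAbs ≤ b := hb ⟨k, hk, rfl⟩
  omega

theorem fitsIn_prod {x : X} {y : Y} {m n : ℕ} :
    FitsIn (x, y) m n ↔ FitsIn x m n ∧ FitsIn y m n := by
  constructor
  · intro h
    exact ⟨fun k hk => h k fun e => hk (congrArg Prod.fst e),
      fun k hk => h k fun e => hk (congrArg Prod.snd e)⟩
  · rintro ⟨h₁, h₂⟩ k hk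
    by_cases hx : symb x k = blank
    · exact h₂ k fun e => hk (Prod.ext hx e)
    · exact h₁ k hx

/-- What an automaton sees on the window `-m, …, n`; the Boolean marks position `0`. -/
def read (x : X) (m n : ℕ) : List (Bool × Letter X) :=
  (List.range (m + n + 1)).map fun i : ℕ => (decide ((i : ℤ) - m = 0), symb x ((i : ℤ) - m))

/-- What an automaton sees at a blank position other than `0`. -/
def pad (X : Type u) [WordLike X] : Bool × Letter X := (false, blank)

@[simp]
theorem length_read (x : X) (m n : ℕ) : (read x m n).length = m + n + 1 := by simp [read]

@[simp]
theorem getElem_read (x : X) (m n i : ℕ) (h : i < (read x m n).length) :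
    (read x m n)[i] = (decide ((i : ℤ) - m = 0), symb x ((i : ℤ) - m)) := by
  simp [read]

theorem read_add {x : X} {m n : ℕ} (h : FitsIn x m n) (i j : ℕ) :
    read x (m + i) (n + j) =
      List.replicate i (pad X) ++ (read x m n ++ List.replicate j (pad X)) := by
  have key : ∀ k : ℤ, k < -m ∨ (n : ℤ) < k → (decide (k = 0), symb x k) = pad X := by
    intro k hk
    have h0 : symb x k = blank := by
      by_contra hne
      have := h k hne
      omega
    have : k ≠ 0 := by omega
    simp [pad, this, h0]
  refine List.ext_getElem (by simp; omega) fun p hp hp' => ?_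
  rw [getElem_read]
  simp only [length_read] at hp
  rw [List.getElem_append]
  split_ifs with h1
  · rw [List.getElem_replicate]
    simp only [List.length_replicate] at h1
    exact key _ (by push_cast; omega)
  · simp only [List.length_replicate] at h1
    rw [List.getElem_append]
    split_ifs with h2
    · rw [getElem_read]
      simp only [length_read, List.length_replicate] at h2
      have : (p : ℤ) - (m + i : ℕ) = ((p - (List.replicate i (pad X)).length : ℕ) : ℤ) - m := by
        simp only [List.length_replicate]; omega
      rw [this]
    · simp only [length_read, List.length_replicate] at h2
      rw [List.getElem_replicate]
      exact key _ (by push_cast; omega)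

theorem read_injective {x y : X} {m n m' n' : ℕ} (hx : FitsIn x m n) (hy : FitsIn y m' n')
    (h : read x m n = read y m' n') : x = y ∧ m = m' ∧ n = n' := by
  have hl : m + n + 1 = m' + n' + 1 := by simpa using congrArg List.length h
  have hget : ∀ p : ℕ, p < m + n + 1 →
      (decide ((p : ℤ) - m = 0), symb x ((p : ℤ) - m)) =
        (decide ((p : ℤ) - m' = 0), symb y ((p : ℤ) - m')) := by
    intro p hp
    have := List.getElem_of_eq h (i := p) (by simpa using hp)
    simpa only [getElem_read] using this
  have hm : m = m' := by
    have := congrArg Prod.fst (hget m (by omega))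
    simp at this
    omega
  subst hm
  obtain rfl : n = n' := by omega
  refine ⟨symb_injective (funext fun k => ?_), rfl, rfl⟩
  by_cases hk : -(m : ℤ) ≤ k ∧ k ≤ n
  · have := congrArg Prod.snd (hget (k + m).toNat (by omega))
    have e : ((k + m).toNat : ℤ) - m = k := by omega
    simpa only [e] using this
  · have h1 : symb x k = blank := by_contra fun hne => hk (hx k hne)
    have h2 : symb y k = blank := by_contra fun hne => hk (hy k hne)
    rw [h1, h2]

/-- The sequence of markers on the window `-m, …, n`. -/
def marks (m n : ℕ) : List Bool :=
  (List.range (m + n + 1)).map fun i : ℕ => decide ((i : ℤ) - m = 0)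

theorem map_fst_read (x : X) (m n : ℕ) : (read x m n).map Prod.fst = marks m n := by
  simp [read, marks]

theorem exists_read_eq {m n : ℕ} {v : List (Bool × Letter X)} (h : v.map Prod.fst = marks m n) :
    ∃ x : X, FitsIn x m n ∧ v = read x m n := by
  classical
  have hl : v.length = m + n + 1 := by simpa [marks] using congrArg List.length h
  obtain ⟨x, hx⟩ := exists_symb_eq (X := X)
    (fun k => if -(m : ℤ) ≤ k ∧ k ≤ n then (v.getD (k + m).toNat (pad X)).2 else blank)
    ((Set.finite_Icc (-(m : ℤ)) n).subset fun k hk => by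
      by_contra hk'
      simp only [Set.mem_ofPred_eq] at hk
      exact hk (if_neg hk'))
  refine ⟨x, fun k hk => by_contra fun hk' => hk ?_, ?_⟩
  · rw [hx]; exact if_neg hk'
  · refine List.ext_getElem (by simp [hl]) fun p hp hp' => ?_
    rw [getElem_read, hx]
    have h1 : v[p].1 = decide ((p : ℤ) - m = 0) := by
      have := List.getElem_of_eq h (i := p) (by simpa using hp)
      simpa [marks] using this
    have h2 : -(m : ℤ) ≤ (p : ℤ) - m ∧ (p : ℤ) - m ≤ n := by omega
    have h3 : ((p : ℤ) - m + m).toNat = p := by omega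
    refine Prod.ext h1 ?_
    simp only [if_pos h2, h3]
    rw [List.getD_eq_getElem _ _ hp]

theorem marks_eq_iff_count {u : List Bool} : (∃ m n, u = marks m n) ↔ u.count true = 1 := by
  have hmarks : ∀ m n, marks m n = List.replicate m false ++ true :: List.replicate n false := by
    intro m n
    refine List.ext_getElem (by simp [marks]; omega) fun p hp hp' => ?_
    simp only [marks, List.getElem_map, List.getElem_range]
    rw [List.getElem_append]
    split_ifs with h1
    · simp only [List.length_replicate] at h1
      simp; omega
    · simp only [List.length_replicate] at h1
      rw [List.getElem_cons]
      split_ifs with h2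
      · simp only [List.length_replicate] at h2
        simp; omega
      · simp only [List.length_replicate] at h2
        simp; omega
  constructor
  · rintro ⟨m, n, rfl⟩
    simp [hmarks, List.count_replicate]
  · intro h
    have hmem : true ∈ u := List.count_pos_iff.1 (by omega)
    obtain ⟨s, t, rfl⟩ := List.append_of_mem hmem
    simp only [List.count_append, List.count_cons_self] at h
    have hfalse : ∀ l : List Bool, l.count true = 0 → l = List.replicate l.length false := by
      intro l hl
      refine List.eq_replicate_of_mem fun b hb => ?_
      cases b with
      | false => rfl
      | true => exact absurd hb (List.count_eq_zero.1 hl)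
    refine ⟨s.length, t.length, ?_⟩
    rw [hmarks, ← hfalse s (by omega), ← hfalse t (by omega)]

/-! ### Recognizable predicates -/

/-- A predicate is recognizable if a regular language decides it on all windows that contain the
domain. Lists that are not the reading of a word may or may not belong to the language. -/
def Recognizable (P : X → Prop) : Prop :=
  ∃ L : Language (Bool × Letter X), L.IsRegular ∧
    ∀ x m n, FitsIn x m n → (read x m n ∈ L ↔ P x)

theorem Recognizable.congr {P Q : X → Prop} (h : Recognizable P) (hPQ : ∀ x, P x ↔ Q x) :
    Recognizable Q := by
  obtain rfl : P = Q := funext fun x => propext (hPQ x)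
  exact h

theorem Recognizable.not {P : X → Prop} (h : Recognizable P) : Recognizable fun x => ¬ P x := by
  obtain ⟨L, hL, hP⟩ := h
  exact ⟨Lᶜ, hL.compl, fun x m n hx => not_congr (hP x m n hx)⟩

theorem Recognizable.and {P Q : X → Prop} (hP : Recognizable P) (hQ : Recognizable Q) :
    Recognizable fun x => P x ∧ Q x := by
  obtain ⟨L, hL, hP⟩ := hP
  obtain ⟨M, hM, hQ⟩ := hQ
  exact ⟨L ⊓ M, hL.inf hM, fun x m n hx => and_congr (hP x m n hx) (hQ x m n hx)⟩

theorem Recognizable.imp {P Q : X → Prop} (hP : Recognizable P) (hQ : Recognizable Q) :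
    Recognizable fun x => P x → Q x :=
  (hP.and hQ.not).not.congr fun x => by tauto

theorem Recognizable.const (p : Prop) : Recognizable fun _ : X => p := by
  classical
  refine ⟨if p then ⊤ else ⊥, ?_, fun x m n _ => ?_⟩
  · have h : (⊥ : Language (Bool × Letter X)).IsRegular :=
      ⟨Unit, inferInstance, ⟨fun _ _ => (), (), ∅⟩, rfl⟩
    split_ifs
    · simpa using h.compl
    · exact h
  · split_ifs with hp
    · exact iff_of_true trivial hp
    · exact iff_of_false (fun h => h) hp

theorem Recognizable.forall_finset {ι : Type*} {P : ι → X → Prop} (s : Finset ι)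
    (h : ∀ i ∈ s, Recognizable (P i)) : Recognizable fun x => ∀ i ∈ s, P i x := by
  classical
  induction s using Finset.induction_on with
  | empty => exact (Recognizable.const True).congr fun x => by simp
  | insert a s _ ih =>
    exact ((h a (Finset.mem_insert_self a s)).and
      (ih fun i hi => h i (Finset.mem_insert_of_mem hi))).congr fun x => by simp

theorem Recognizable.forall_fintype {ι : Type*} [Finite ι] {P : ι → X → Prop}
    (h : ∀ i, Recognizable (P i)) : Recognizable fun x => ∀ i, P i x := by
  have := Fintype.ofFinite ι
  exact (Recognizable.forall_finset Finset.univ fun i _ => h i).congr fun x => by simp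

theorem Recognizable.exists_fintype {ι : Type*} [Finite ι] {P : ι → X → Prop}
    (h : ∀ i, Recognizable (P i)) : Recognizable fun x => ∃ i, P i x :=
  (Recognizable.forall_fintype fun i => (h i).not).not.congr fun x => by simp

/-- A map between words that acts on each position separately, in the same way at all positions,
and maps blanks to blanks. -/
@[fun_prop]
def Letterwise (g : X → Y) : Prop :=
  ∃ φ : Letter X → Letter Y, φ blank = blank ∧ ∀ x k, symb (g x) k = φ (symb x k)

@[fun_prop]
theorem Letterwise.id : Letterwise fun x : X => x := ⟨fun a => a, rfl, fun _ _ => rfl⟩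

@[fun_prop]
theorem Letterwise.comp {f : Y → Z} {g : X → Y} (hf : Letterwise f) (hg : Letterwise g) :
    Letterwise fun x => f (g x) := by
  obtain ⟨φ, h₀, h⟩ := hf
  obtain ⟨ψ, h₀', h'⟩ := hg
  exact ⟨fun a => φ (ψ a), (congrArg φ h₀').trans h₀, fun x k => by rw [h, h']⟩

@[fun_prop]
theorem Letterwise.fst : Letterwise (Prod.fst : X × Y → X) := ⟨Prod.fst, rfl, fun _ _ => rfl⟩

@[fun_prop]
theorem Letterwise.snd : Letterwise (Prod.snd : X × Y → Y) := ⟨Prod.snd, rfl, fun _ _ => rfl⟩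

@[fun_prop]
theorem Letterwise.prodMk {f : X → Y} {g : X → Z} (hf : Letterwise f) (hg : Letterwise g) :
    Letterwise fun x => (f x, g x) := by
  obtain ⟨φ, h₀, h⟩ := hf
  obtain ⟨ψ, h₀', h'⟩ := hg
  exact ⟨fun a => (φ a, ψ a), Prod.ext h₀ h₀', fun x k => Prod.ext (h x k) (h' x k)⟩

theorem FitsIn.map {g : X → Y} (hg : Letterwise g) {x : X} {m n : ℕ} (h : FitsIn x m n) :
    FitsIn (g x) m n := by
  obtain ⟨φ, h₀, h'⟩ := hg
  refine fun k hk => h k fun e => hk ?_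
  rw [h', e, h₀]

/-- `P` may be applied to any word that is obtained letter by letter. -/
theorem Recognizable.comp {P : Y → Prop} (hP : Recognizable P) {g : X → Y} (hg : Letterwise g) :
    Recognizable fun x => P (g x) := by
  obtain ⟨L, ⟨σ, _, M, rfl⟩, hP⟩ := hP
  obtain ⟨φ, h₀, h⟩ := id hg
  refine ⟨(M.comap (Prod.map id φ)).accepts, ⟨σ, inferInstance, _, rfl⟩, fun x m n hx => ?_⟩
  refine Iff.trans ?_ (hP (g x) m n (hx.map hg))
  rw [DFA.accepts_comap]
  have : (read x m n).map (Prod.map id φ) = read (g x) m n := by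
    simp [read, Function.comp_def, h]
  rw [← this]
  rfl

theorem Recognizable.comp₂ {P : Y → Z → Prop} (hP : Recognizable fun p : Y × Z => P p.1 p.2)
    {f : X → Y} {g : X → Z} (hf : Letterwise f) (hg : Letterwise g) :
    Recognizable fun x => P (f x) (g x) :=
  hP.comp (hf.prodMk hg)

/-! ### Quantifiers -/

/-- Every list that a regular language accepts and that spells `x` in its first component also
spells a partner `y` of `x` in its second component. -/
theorem exists_of_map_eq_read {P : X × Y → Prop} {L : Language (Bool × Letter (X × Y))}
    (hL : ∀ z m n, FitsIn z m n → (read z m n ∈ L ↔ P z)) {v : List (Bool × Letter (X × Y))}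
    (hv : v ∈ L) {x : X} {m n : ℕ} (hx : FitsIn x m n)
    (h : v.map (Prod.map id Prod.fst) = read x m n) : ∃ y, P (x, y) ∧ FitsIn y m n := by
  have h1 : v.map Prod.fst = marks m n := by
    rw [← map_fst_read x, ← h]
    simp [Function.comp_def]
  obtain ⟨⟨x', y⟩, hz, rfl⟩ := exists_read_eq h1
  have h2 : read x' m n = read x m n := by
    rw [← h]
    simp [read, Function.comp_def, symb]
  obtain ⟨rfl, -⟩ := read_injective (fitsIn_prod.1 hz).1 hx h2
  exact ⟨y, (hL _ _ _ hz).1 hv, (fitsIn_prod.1 hz).2⟩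

theorem map_read_prod (x : X) (y : Y) (m n : ℕ) :
    (read (x, y) m n).map (Prod.map id Prod.fst) = read x m n := by
  simp [read, Function.comp_def, symb]

/-- The language of all lists that become, after padding, the image of a list in a regular language
is regular: a left quotient by `u` depends only on the set of states in which the automaton can
be after reading a preimage of a padding of `u`. -/
theorem isRegular_unpad_map {α β : Type*} {L : Language α} (hL : L.IsRegular) (f : α → β) (b : β) :
    Language.IsRegular ({u | ∃ i j, ∃ v ∈ L, v.map f =
      List.replicate i b ++ (u ++ List.replicate j b)} : Language β) := by
  obtain ⟨σ, _, M, rfl⟩ := hL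
  refine Language.IsRegular.of_finite_range_leftQuotient ?_
  let F : Set σ → Language β := fun S =>
    {w | ∃ q ∈ S, ∃ j v, v.map f = w ++ List.replicate j b ∧ M.evalFrom q v ∈ M.accept}
  let T : List β → Set σ := fun u =>
    {q | ∃ i v, v.map f = List.replicate i b ++ u ∧ M.eval v = q}
  refine (Set.finite_range F).subset ?_
  rintro _ ⟨u, rfl⟩
  refine ⟨T u, ?_⟩
  ext w
  constructor
  · rintro ⟨q, ⟨i, v, hv, rfl⟩, j, v', hv', hacc⟩
    refine ⟨i, j, v ++ v', ?_, ?_⟩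
    · rw [DFA.mem_accepts, DFA.eval, DFA.evalFrom_of_append]
      exact hacc
    · simp [hv, hv']
  · rintro ⟨i, j, v, hv, h⟩
    rw [List.append_assoc, ← List.append_assoc, List.map_eq_append_iff] at h
    obtain ⟨v₁, v₂, rfl, h₁, h₂⟩ := h
    refine ⟨_, ⟨i, v₁, h₁, rfl⟩, j, v₂, h₂, ?_⟩
    rw [DFA.mem_accepts, DFA.eval, DFA.evalFrom_of_append] at hv
    exact hv

theorem Recognizable.exists {P : X → Y → Prop} (h : Recognizable fun p : X × Y => P p.1 p.2) :
    Recognizable fun x => ∃ y, P x y := by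
  obtain ⟨L, hL, hP⟩ := h
  refine ⟨_, isRegular_unpad_map hL (Prod.map id Prod.fst) (pad X), fun x m n hx => ?_⟩
  constructor
  · rintro ⟨i, j, v, hv, h⟩
    rw [← read_add hx] at h
    obtain ⟨y, hy, -⟩ := exists_of_map_eq_read hP hv (hx.mono (by omega) (by omega)) h
    exact ⟨y, hy⟩
  · rintro ⟨y, hy⟩
    obtain ⟨k, hk⟩ := exists_fitsIn y
    refine ⟨k, k, read (x, y) (m + k) (n + k), ?_, ?_⟩
    · exact (hP _ _ _ (fitsIn_prod.2 ⟨hx.mono (by omega) (by omega),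
        hk.mono (by omega) (by omega)⟩)).2 hy
    · rw [map_read_prod, read_add hx]

theorem Recognizable.forall {P : X → Y → Prop} (h : Recognizable fun p : X × Y => P p.1 p.2) :
    Recognizable fun x => ∀ y, P x y :=
  (Recognizable.exists (P := fun x y => ¬ P x y) h.not).not.congr fun x => by simp

/-- Witnesses for a recognizable relation can be chosen only boundedly longer than the given word:
outside the window of the word, the automaton needs only as many letters as it takes to get from
one of its finitely many states to another. -/
theorem Recognizable.exists_short_witness {P : X → Y → Prop}
    (h : Recognizable fun p : X × Y => P p.1 p.2) :
    ∃ C, ∀ x n, FitsIn x n n → (∃ y, P x y) → ∃ y, P x y ∧ FitsIn y (n + C) (n + C) := by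
  classical
  obtain ⟨L, ⟨σ, _, M, rfl⟩, hP⟩ := h
  let f : Bool × Letter (X × Y) → Bool × Letter X := Prod.map id Prod.fst
  -- `i q` letters lead from the start to `q`, and `j q` letters lead from `q` to acceptance
  have hleft : ∀ q : σ, ∃ i : ℕ, (∃ v, M.eval v = q ∧ ∃ k, v.map f = List.replicate k (pad X)) →
      ∃ v, M.eval v = q ∧ v.map f = List.replicate i (pad X) := by
    intro q
    by_cases hq : ∃ v, M.eval v = q ∧ ∃ k, v.map f = List.replicate k (pad X)
    · obtain ⟨v, hv, k, hk⟩ := hq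
      exact ⟨k, fun _ => ⟨v, hv, hk⟩⟩
    · exact ⟨0, fun h => absurd h hq⟩
  have hright : ∀ q : σ, ∃ j : ℕ,
      (∃ v, M.evalFrom q v ∈ M.accept ∧ ∃ k, v.map f = List.replicate k (pad X)) →
      ∃ v, M.evalFrom q v ∈ M.accept ∧ v.map f = List.replicate j (pad X) := by
    intro q
    by_cases hq : ∃ v, M.evalFrom q v ∈ M.accept ∧ ∃ k, v.map f = List.replicate k (pad X)
    · obtain ⟨v, hv, k, hk⟩ := hq
      exact ⟨k, fun _ => ⟨v, hv, hk⟩⟩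
    · exact ⟨0, fun h => absurd h hq⟩
  choose i hi using hleft
  choose j hj using hright
  refine ⟨Finset.univ.sup i + Finset.univ.sup j, fun x n hx ⟨y, hy⟩ => ?_⟩
  obtain ⟨k, hk⟩ := exists_fitsIn y
  have hacc : read (x, y) (n + k) (n + k) ∈ M.accepts :=
    (hP _ _ _ (fitsIn_prod.2 ⟨hx.mono (by omega) (by omega), hk.mono (by omega) (by omega)⟩)).2 hy
  have hmap : (read (x, y) (n + k) (n + k)).map f =
      List.replicate k (pad X) ++ (read x n n ++ List.replicate k (pad X)) := by
    rw [map_read_prod, read_add hx]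
  obtain ⟨a, bc, hbc, ha, hmap'⟩ := List.map_eq_append_iff.1 hmap
  obtain ⟨b, c, rfl, hb, hc⟩ := List.map_eq_append_iff.1 hmap'
  rw [hbc, DFA.mem_accepts, DFA.eval, DFA.evalFrom_of_append, DFA.evalFrom_of_append] at hacc
  obtain ⟨a', ha', hia⟩ := hi (M.eval a) ⟨a, rfl, k, ha⟩
  obtain ⟨c', hc', hjc⟩ := hj _ ⟨c, hacc, k, hc⟩
  have hi' : i (M.eval a) ≤ Finset.univ.sup i := Finset.le_sup (Finset.mem_univ _)
  have hj' : j (M.evalFrom (M.evalFrom M.start a) b) ≤ Finset.univ.sup j :=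
    Finset.le_sup (Finset.mem_univ _)
  obtain ⟨y', hy', hfit⟩ := exists_of_map_eq_read (v := a' ++ (b ++ c')) (x := x)
    (m := n + i (M.eval a)) (n := n + j (M.evalFrom (M.evalFrom M.start a) b)) hP (by
      rw [DFA.mem_accepts, DFA.eval, DFA.evalFrom_of_append, DFA.evalFrom_of_append]
      rw [← DFA.eval, ha']
      exact hc') (hx.mono (by omega) (by omega)) (by
      rw [read_add hx, List.map_append, List.map_append]
      exact congrArg₂ _ hia (congrArg₂ _ hb hjc))
  exact ⟨y', hy', hfit.mono (by omega) (by omega)⟩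

/-! ### Local constraints and single words -/

theorem isRegular_isChain {α : Type*} [Finite α] (ρ : α → α → Prop) (b : α) :
    Language.IsRegular ({u | List.IsChain ρ (b :: (u ++ [b]))} : Language α) := by
  refine Language.IsRegular.of_finite_range_leftQuotient ?_
  -- what matters of `u` is whether `b :: u` is a chain and what its last letter is
  let F : Prop × α → Language α := fun s => {w | s.1 ∧ List.IsChain ρ (s.2 :: (w ++ [b]))}
  refine (Set.finite_range F).subset ?_
  rintro _ ⟨u, rfl⟩
  refine ⟨(List.IsChain ρ (b :: u), (b :: u).getLast (by simp)), ?_⟩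
  ext w
  have key : ∀ (u : List α) (b : α) (t : List α), List.IsChain ρ (b :: (u ++ t)) ↔
      List.IsChain ρ (b :: u) ∧ List.IsChain ρ ((b :: u).getLast (by simp) :: t) := by
    intro u
    induction u with
    | nil => intro b t; simp
    | cons a u ih =>
      intro b t
      rw [List.cons_append, List.isChain_cons_cons, List.isChain_cons_cons, ih a t,
        List.getLast_cons (a := b) (List.cons_ne_nil a u), and_assoc]
  show _ ∧ _ ↔ List.IsChain ρ (b :: (u ++ w ++ [b]))
  rw [List.append_assoc, key u b]

/-- Constraints on all pairs of neighbouring letters are recognizable. -/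
theorem Recognizable.of_local (ρ : Bool × Letter X → Bool × Letter X → Prop)
    (hρ : ρ (pad X) (pad X)) : Recognizable fun x : X =>
      ∀ k : ℤ, ρ (decide (k = 0), symb x k) (decide (k + 1 = 0), symb x (k + 1)) := by
  refine ⟨_, isRegular_isChain ρ (pad X), fun x m n hx => ?_⟩
  have hread : pad X :: (read x m n ++ [pad X]) = read x (m + 1) (n + 1) := by
    rw [read_add hx]; rfl
  show List.IsChain ρ (pad X :: (read x m n ++ [pad X])) ↔ _
  rw [hread, List.isChain_iff_getElem]
  constructor
  · intro h k
    by_cases hk : -(m + 1 : ℤ) ≤ k ∧ k ≤ n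
    · have := h (k + (m + 1)).toNat (by simp; omega)
      rw [getElem_read, getElem_read] at this
      convert this using 4 <;> omega
    · have h0 : ∀ l : ℤ, l < -m ∨ (n : ℤ) < l → symb x l = blank := fun l hl => by
        by_contra hne
        have := hx l hne
        omega
      have e1 : (decide (k = 0), symb x k) = pad X := by
        rw [h0 k (by omega)]
        have : k ≠ 0 := by omega
        simp [pad, this]
      have e2 : (decide (k + 1 = 0), symb x (k + 1)) = pad X := by
        rw [h0 (k + 1) (by omega)]
        have : k + 1 ≠ 0 := by omega
        simp [pad, this]
      rw [e1, e2]
      exact hρ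
  · intro h i hi
    rw [getElem_read, getElem_read]
    have := h ((i : ℤ) - (m + 1 : ℕ))
    have e : (i : ℤ) - (m + 1 : ℕ) + 1 = (i + 1 : ℕ) - (m + 1 : ℕ) := by push_cast; ring
    rwa [e] at this

theorem Recognizable.of_pointwise (σ : Letter X → Prop) (hσ : σ blank) :
    Recognizable fun x : X => ∀ k : ℤ, σ (symb x k) :=
  Recognizable.of_local (fun a _ => σ a.2) hσ

theorem recognizable_symbol_iff_eq (k : ℤ) :
    Recognizable fun e : Word Unit => ∀ j, e.symbol j ≠ none ↔ j = k := by
  have hshift : Recognizable fun p : Word Unit × Word Unit =>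
      ∀ j, p.1.symbol j = p.2.symbol (j + 1) :=
    Recognizable.of_local (X := Word Unit × Word Unit) 
      (fun a b : Bool × Option Unit × Option Unit => a.2.1 = b.2.2) rfl
  have hex : ∀ f : ℤ → Option Unit, ∀ k, (∀ j, f j ≠ none ↔ j = k) →
      ∃ e : Word Unit, e.symbol = f := fun f k hf =>
    ⟨⟨f, (Set.finite_singleton k).subset fun j hj => (hf j).1 hj⟩, rfl⟩
  induction k using Int.induction_on with
  | zero =>
    refine (Recognizable.of_local (X := Word Unit) (fun a _ => a.2 ≠ none ↔ a.1 = true)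
      (by simp [pad, blank])).congr fun e => ?_
    simp [symb]
  | succ k ih =>
    refine (Recognizable.exists (X := Word Unit) (Y := Word Unit) (P := fun e d =>
      (∀ j, d.symbol j ≠ none ↔ j = k) ∧ ∀ j, d.symbol j = e.symbol (j + 1))
      ((ih.comp Letterwise.snd).and
        (hshift.comp (Letterwise.snd.prodMk Letterwise.fst)))).congr fun e => ?_
    constructor
    · rintro ⟨d, hd, h⟩ j
      have := h (j - 1)
      rw [sub_add_cancel] at this
      rw [← this, hd]
      omega
    · intro he
      obtain ⟨d, hd⟩ := hex (fun j => e.symbol (j + 1)) k fun j => by rw [he]; omega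
      exact ⟨d, fun j => by rw [hd, he]; omega, fun j => by rw [hd]⟩
  | pred k ih =>
    refine (Recognizable.exists (X := Word Unit) (Y := Word Unit) (P := fun e d =>
      (∀ j, d.symbol j ≠ none ↔ j = -(k : ℤ)) ∧ ∀ j, e.symbol j = d.symbol (j + 1))
      ((ih.comp Letterwise.snd).and hshift)).congr fun e => ?_
    constructor
    · rintro ⟨d, hd, h⟩ j
      rw [h, hd]
      omega
    · intro he
      obtain ⟨d, hd⟩ := hex (fun j => e.symbol (j - 1)) (-k) fun j => by rw [he]; omega
      exact ⟨d, fun j => by rw [hd, he]; omega, fun j => by simp [hd]⟩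

theorem recognizable_eq_const (c : X) : Recognizable fun x : X => x = c := by
  classical
  suffices H : ∀ (s : Finset ℤ) (c : X), (∀ k, k ∉ s → symb c k = blank) →
      Recognizable fun x : X => x = c from
    H (finite_support c).toFinset c fun k hk => by simpa using hk
  intro s
  induction s using Finset.induction_on with
  | empty =>
    intro c hc
    refine (Recognizable.of_pointwise (X := X) (fun a => a = blank) rfl).congr fun x => ?_
    rw [← symb_injective.eq_iff, funext_iff]
    exact forall_congr' fun k => by rw [hc k (by simp)]
  | insert a s _ ih =>
    intro c hc
    obtain ⟨c', hc'⟩ := exists_symb_eq (X := X) (fun k => if k = a then blank else symb c k)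
      ((finite_support c).subset fun k hk h => hk (by simp [h]))
    have h1 : Recognizable fun x : X => x = c' := ih c' fun k hk => by
      rw [hc']
      by_cases hka : k = a
      · simp [hka]
      · simpa [hka] using hc k (by simp [hka, hk])
    have h2 : Recognizable fun p : (X × X) × Word Unit => ∀ k : ℤ,
        symb p.1.1 k = if p.2.symbol k = none then symb p.1.2 k else symb c a := by
      refine Recognizable.of_pointwise (X := (X × X) × Word Unit)
        (fun l : (Letter X × Letter X) × Option Unit => l.1.1 = if l.2 = none then l.1.2 else symb c a) ?_
      exact (if_pos rfl).symm
    refine (Recognizable.exists (P := fun x y => ∃ e : Word Unit, (y = c' ∧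
      ∀ j, e.symbol j ≠ none ↔ j = a) ∧ ∀ k : ℤ,
        symb x k = if e.symbol k = none then symb y k else symb c a)
      (Recognizable.exists (X := X × X) (((h1.comp (Letterwise.snd.comp Letterwise.fst)).and
        ((recognizable_symbol_iff_eq a).comp Letterwise.snd)).and h2))).congr fun x => ?_
    constructor
    · rintro ⟨_, e, ⟨rfl, he⟩, h⟩
      refine symb_injective (funext fun k => ?_)
      rw [h, hc']
      by_cases hk : k = a
      · rw [if_neg ((he k).2 hk), hk]
      · have : e.symbol k = none := by_contra fun h => hk ((he k).1 h)
        simp [this, hk]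
    · rintro rfl
      refine ⟨c', ⟨fun j => if j = a then some () else none,
        (Set.finite_singleton a).subset fun j hj => ?_⟩, ⟨rfl, fun j => ?_⟩, fun k => ?_⟩
      · by_contra h
        exact hj (if_neg h)
      · simp
      · by_cases hk : k = a <;> simp [hk, hc']

end WordLike

/-! ### Regular sets and automatic relations as recognizable predicates -/

section Bridge

open WordLike

variable {A : Type u} {B : Type v} {C : Type w} [Finite A] [Finite B] [Finite C]

theorem Word.domain_subset_iff_fitsIn {w : Word A} {m n : ℕ} :
    w.domain ⊆ Set.Icc (-(m : ℤ)) (n : ℤ) ↔ FitsIn w m n := Iff.rfl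

theorem isRegular_count_fst {α : Type*} :
    Language.IsRegular ({u | (u.map Prod.fst).count true = 1} : Language (Bool × α)) := by
  refine Language.IsRegular.of_finite_range_leftQuotient ?_
  let F : Option Bool → Language (Bool × α) := fun s =>
    {w | (match s with | none => 2 | some b => b.toNat) + (w.map Prod.fst).count true = 1}
  refine (Set.finite_range F).subset ?_
  rintro _ ⟨u, rfl⟩
  have h : ∀ w : List (Bool × α), w ∈ Language.leftQuotient
      ({u | (u.map Prod.fst).count true = 1} : Language (Bool × α)) u ↔
        (u.map Prod.fst).count true + (w.map Prod.fst).count true = 1 := fun w => by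
    show ((u ++ w).map Prod.fst).count true = 1 ↔ _
    rw [List.map_append, List.count_append]
  rcases hu : (u.map Prod.fst).count true with _ | _ | k
  · refine ⟨some false, Set.ext fun w => ((h w).trans ?_).symm⟩
    rw [hu]; rfl
  · refine ⟨some true, Set.ext fun w => ((h w).trans ?_).symm⟩
    rw [hu]; rfl
  · refine ⟨none, Set.ext fun w => ((h w).trans ?_).symm⟩
    rw [hu]
    show _ ↔ 2 + (w.map Prod.fst).count true = 1
    omega

theorem isRegularSet_iff_recognizable {L : Set (Word A)} :
    IsRegularSet L ↔ Recognizable fun w : Word A => w ∈ L := by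
  constructor
  · intro h
    refine ⟨_, h, fun w m n hw => ⟨?_, fun h => ⟨w, h, m, n, hw, rfl⟩⟩⟩
    rintro ⟨w', hw', m', n', hfit, he⟩
    obtain ⟨rfl, -⟩ := read_injective hw (Word.domain_subset_iff_fitsIn.1 hfit) he
    exact hw'
  · rintro ⟨M, hM, h⟩
    have hreg := hM.inf (isRegular_count_fst (α := Option A))
    refine (congrArg Language.IsRegular (Set.ext fun u => ?_)).mpr hreg
    constructor
    · rintro ⟨w, hw, m, n, hfit, rfl⟩
      exact ⟨(h w m n hfit).2 hw, marks_eq_iff_count.1 ⟨m, n, map_fst_read w m n⟩⟩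
    · rintro ⟨hu, hc⟩
      obtain ⟨m, n, hmn⟩ := marks_eq_iff_count.2 hc
      obtain ⟨w, hfit, rfl⟩ := exists_read_eq (X := Word A) hmn
      exact ⟨w, (h w m n hfit).1 hu, m, n, hfit, rfl⟩

/-- Applied to convolutions, this allows treating automatic relations, which are defined through
sets of convolutions, as recognizable predicates on tuples of words. -/
theorem recognizable_image_iff {X : Type u} {Y : Type v} [WordLike X] [WordLike Y] {g : X → Y}
    (hg : Letterwise g) (hinj : Function.Injective g) {P : X → Prop} :
    (Recognizable fun y => ∃ x, P x ∧ y = g x) ↔ Recognizable P := by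
  constructor
  · intro h
    refine (h.comp hg).congr fun x => ⟨?_, fun hx => ⟨x, hx, rfl⟩⟩
    rintro ⟨x', hx', h⟩
    rwa [hinj h]
  · intro h
    have heq : Recognizable fun p : Y × X => p.1 = g p.2 := by
      obtain ⟨φ, h₀, hφ⟩ := hg
      refine (Recognizable.of_pointwise (X := Y × X)
        (fun l : Letter Y × Letter X => l.1 = φ l.2) h₀.symm).congr fun p => ?_
      rw [← symb_injective.eq_iff, funext_iff]
      exact forall_congr' fun k => by rw [hφ]; rfl
    exact Recognizable.exists (P := fun y x => P x ∧ y = g x) ((h.comp Letterwise.snd).and heq)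

theorem letterwise_conv : Letterwise fun p : Word A × Word B => Word.conv p.1 p.2 :=
  ⟨fun l : Option A × Option B => if l.1 = none ∧ l.2 = none then none else some l,
    if_pos ⟨rfl, rfl⟩, fun _ _ => rfl⟩

theorem letterwise_conv₃ :
    Letterwise fun p : Word A × Word B × Word C => Word.conv₃ p.1 p.2.1 p.2.2 :=
  ⟨fun l : Option A × Option B × Option C =>
    if l.1 = none ∧ l.2.1 = none ∧ l.2.2 = none then none else some l,
    if_pos ⟨rfl, rfl, rfl⟩, fun _ _ => rfl⟩

theorem conv_injective : Function.Injective fun p : Word A × Word B => Word.conv p.1 p.2 := by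
  intro p q h
  refine symb_injective (funext fun k => ?_)
  have hk : (Word.conv p.1 p.2).symbol k = (Word.conv q.1 q.2).symbol k :=
    congrArg (fun w => w.symbol k) h
  simp only [Word.conv] at hk
  show (p.1.symbol k, p.2.symbol k) = (q.1.symbol k, q.2.symbol k)
  split_ifs at hk with h1 h2 h2
  · rw [h1.1, h1.2, h2.1, h2.2]
  · exact Option.some_injective _ hk

theorem conv₃_injective :
    Function.Injective fun p : Word A × Word B × Word C => Word.conv₃ p.1 p.2.1 p.2.2 := by
  intro p q h
  refine symb_injective (funext fun k => ?_)
  have hk : (Word.conv₃ p.1 p.2.1 p.2.2).symbol k = (Word.conv₃ q.1 q.2.1 q.2.2).symbol k :=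
    congrArg (fun w => w.symbol k) h
  simp only [Word.conv₃] at hk
  show (p.1.symbol k, p.2.1.symbol k, p.2.2.symbol k) =
    (q.1.symbol k, q.2.1.symbol k, q.2.2.symbol k)
  split_ifs at hk with h1 h2 h2
  · rw [h1.1, h1.2.1, h1.2.2, h2.1, h2.2.1, h2.2.2]
  · exact Option.some_injective _ hk

theorem isAutomaticRel₂_iff_recognizable {R : Word A → Word B → Prop} :
    IsAutomaticRel₂ R ↔ Recognizable fun p : Word A × Word B => R p.1 p.2 := by
  rw [IsAutomaticRel₂, isRegularSet_iff_recognizable,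
    ← recognizable_image_iff letterwise_conv conv_injective]
  simp only [Set.mem_ofPred_eq, Prod.exists]

theorem isAutomaticRel₃_iff_recognizable {R : Word A → Word B → Word C → Prop} :
    IsAutomaticRel₃ R ↔ Recognizable fun p : Word A × Word B × Word C => R p.1 p.2.1 p.2.2 := by
  rw [IsAutomaticRel₃, isRegularSet_iff_recognizable,
    ← recognizable_image_iff letterwise_conv₃ conv₃_injective]
  simp only [Set.mem_ofPred_eq, Prod.exists]

end Bridge

/-! ### Half-planes and unions of cells -/

namespace SemiautomaticGrid

open WordLike

variable {S : Type u} (G : SemiautomaticGrid S)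

theorem exists_word {a : ℝ} (ha : a ∈ G.ring) : ∃ w ∈ G.words, G.val w = a := by
  have : a ∈ G.val '' G.words := by rw [G.image_val]; exact ha
  exact this

theorem val_mem {w : Word S} (hw : w ∈ G.words) : G.val w ∈ G.ring := by
  have : G.val w ∈ G.val '' G.words := ⟨w, hw, rfl⟩
  rwa [G.image_val] at this

variable [Finite S] {X : Type v} [WordLike X] {f g h : X → Word S}

theorem recognizable_mem_words (hf : Letterwise f) : Recognizable fun x => f x ∈ G.words :=
  (isRegularSet_iff_recognizable.1 G.regular_words).comp hf

theorem recognizable_lt (hf : Letterwise f) (hg : Letterwise g) : Recognizable fun x =>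
    f x ∈ G.words ∧ g x ∈ G.words ∧ G.val (f x) < G.val (g x) :=
  (isAutomaticRel₂_iff_recognizable.1 G.automatic_lt).comp (hf.prodMk hg)

theorem recognizable_eq (hf : Letterwise f) (hg : Letterwise g) : Recognizable fun x =>
    f x ∈ G.words ∧ g x ∈ G.words ∧ G.val (f x) = G.val (g x) :=
  (isAutomaticRel₂_iff_recognizable.1 G.automatic_eq).comp (hf.prodMk hg)

theorem recognizable_add (hf : Letterwise f) (hg : Letterwise g) (hh : Letterwise h) :
    Recognizable fun x => f x ∈ G.words ∧ g x ∈ G.words ∧ h x ∈ G.words ∧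
      G.val (f x) + G.val (g x) = G.val (h x) :=
  (isAutomaticRel₃_iff_recognizable.1 G.automatic_add).comp (hf.prodMk (hg.prodMk hh))

theorem recognizable_mul {a : Word S} (ha : a ∈ G.words) (hf : Letterwise f) (hg : Letterwise g) :
    Recognizable fun x => f x ∈ G.words ∧ g x ∈ G.words ∧ G.val a * G.val (f x) = G.val (g x) :=
  (isAutomaticRel₂_iff_recognizable.1 (G.semiautomatic_mul_left a ha)).comp (hf.prodMk hg)

theorem isRegularSet_trace_iff {P : Set (ℝ × ℝ)} : IsRegularSet (G.trace P) ↔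
    Recognizable fun p : Word S × Word S =>
      p.1 ∈ G.words ∧ p.2 ∈ G.words ∧ (G.val p.1, G.val p.2) ∈ P := by
  rw [← isAutomaticRel₂_iff_recognizable (R := fun x y =>
    x ∈ G.words ∧ y ∈ G.words ∧ (G.val x, G.val y) ∈ P)]
  refine iff_of_eq (congrArg IsRegularSet (Set.ext fun u => ?_))
  constructor
  · rintro ⟨x, hx, y, hy, h, rfl⟩
    exact ⟨x, y, ⟨hx, hy, h⟩, rfl⟩
  · rintro ⟨x, y, ⟨hx, hy, h⟩, rfl⟩
    exact ⟨x, hx, y, hy, h, rfl⟩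

theorem conv_mem_trace_iff {P : Set (ℝ × ℝ)} {x y : Word S} : Word.conv x y ∈ G.trace P ↔
    x ∈ G.words ∧ y ∈ G.words ∧ (G.val x, G.val y) ∈ P := by
  constructor
  · rintro ⟨x', hx, y', hy, h, he⟩
    obtain ⟨rfl, rfl⟩ := Prod.ext_iff.1 (conv_injective (a₁ := (x, y)) (a₂ := (x', y')) he)
    exact ⟨hx, hy, h⟩
  · rintro ⟨hx, hy, h⟩
    exact ⟨x, hx, y, hy, h, rfl⟩

/-- Open half-planes with coefficients in the grid are regular. Only products with the fixed
coefficients are needed, so that semiautomatic multiplication suffices. -/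
theorem recognizable_halfplane {a b c : ℝ} (ha : a ∈ G.ring) (hb : b ∈ G.ring) (hc : c ∈ G.ring) :
    Recognizable fun p : Word S × Word S =>
      p.1 ∈ G.words ∧ p.2 ∈ G.words ∧ a * G.val p.1 + b * G.val p.2 < c := by
  obtain ⟨wa, hwa, rfl⟩ := G.exists_word ha
  obtain ⟨wb, hwb, rfl⟩ := G.exists_word hb
  obtain ⟨wc, hwc, rfl⟩ := G.exists_word hc
  have H : Recognizable fun p : Word S × Word S => ∃ u v w z,
      z = wc ∧ (p.1 ∈ G.words ∧ u ∈ G.words ∧ G.val wa * G.val p.1 = G.val u) ∧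
      (p.2 ∈ G.words ∧ v ∈ G.words ∧ G.val wb * G.val p.2 = G.val v) ∧
      (u ∈ G.words ∧ v ∈ G.words ∧ w ∈ G.words ∧ G.val u + G.val v = G.val w) ∧
      (w ∈ G.words ∧ z ∈ G.words ∧ G.val w < G.val z) := by
    refine .exists <| .exists <| .exists <| .exists <| .and ?_ <| .and ?_ <| .and ?_ <| .and ?_ ?_
    · exact (recognizable_eq_const wc).comp (by fun_prop)
    · exact G.recognizable_mul hwa (by fun_prop) (by fun_prop)
    · exact G.recognizable_mul hwb (by fun_prop) (by fun_prop)
    · exact G.recognizable_add (by fun_prop) (by fun_prop) (by fun_prop)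
    · exact G.recognizable_lt (by fun_prop) (by fun_prop)
  refine H.congr fun p => ⟨?_, ?_⟩
  · rintro ⟨u, v, w, z, rfl, ⟨h1, -, hu⟩, ⟨h2, -, hv⟩, ⟨-, -, -, hw⟩, -, -, hlt⟩
    exact ⟨h1, h2, by rw [hu, hv, hw]; exact hlt⟩
  · rintro ⟨h1, h2, hlt⟩
    obtain ⟨u, hu, hu'⟩ := G.exists_word (mul_mem ha (G.val_mem h1))
    obtain ⟨v, hv, hv'⟩ := G.exists_word (mul_mem hb (G.val_mem h2))
    obtain ⟨w, hw, hw'⟩ := G.exists_word (add_mem (G.val_mem hu) (G.val_mem hv))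
    exact ⟨u, v, w, wc, rfl, ⟨h1, hu, hu'.symm⟩, ⟨h2, hv, hv'.symm⟩, ⟨hu, hv, hw, hw'.symm⟩,
      hw, hwc, by rw [hw', hu', hv']; exact hlt⟩

/-- Affine functions on the plane with coefficients in the grid. -/
def IsAffine (f : ℝ × ℝ → ℝ) : Prop :=
  ∃ a ∈ G.ring, ∃ b ∈ G.ring, ∃ c ∈ G.ring, ∀ p, f p = a * p.1 + b * p.2 + c

theorem recognizable_sign_eq {f : ℝ × ℝ → ℝ} (hf : G.IsAffine f) (s : SignType) :
    Recognizable fun p : Word S × Word S => p.1 ∈ G.words ∧ p.2 ∈ G.words ∧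
      SignType.sign (f (G.val p.1, G.val p.2)) = s := by
  obtain ⟨a, ha, b, hb, c, hc, hf⟩ := hf
  have hneg := G.recognizable_halfplane ha hb (neg_mem hc)
  have hpos := G.recognizable_halfplane (neg_mem ha) (neg_mem hb) hc
  have hneg' : ∀ p : Word S × Word S, a * G.val p.1 + b * G.val p.2 < -c ↔
      f (G.val p.1, G.val p.2) < 0 := fun p => by rw [hf]; constructor <;> intro <;> linarith
  have hpos' : ∀ p : Word S × Word S, -a * G.val p.1 + -b * G.val p.2 < c ↔
      0 < f (G.val p.1, G.val p.2) := fun p => by rw [hf]; constructor <;> intro <;> linarith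
  simp only [hneg', hpos'] at hneg hpos
  have hw : Recognizable fun p : Word S × Word S => p.1 ∈ G.words ∧ p.2 ∈ G.words :=
    (G.recognizable_mem_words Letterwise.fst).and
      (G.recognizable_mem_words Letterwise.snd)
  rcases s with _ | _ | _
  · refine (hw.and (hneg.not.and hpos.not)).congr fun p => ?_
    show _ ↔ _ ∧ _ ∧ _ = (0 : SignType)
    rw [sign_eq_zero_iff]
    constructor
    · rintro ⟨⟨h1, h2⟩, h3, h4⟩
      exact ⟨h1, h2, le_antisymm (not_lt.1 fun h => h4 ⟨h1, h2, h⟩)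
        (not_lt.1 fun h => h3 ⟨h1, h2, h⟩)⟩
    · rintro ⟨h1, h2, h3⟩
      exact ⟨⟨h1, h2⟩, fun h => h.2.2.ne h3, fun h => h.2.2.ne' h3⟩
  · refine hneg.congr fun p => ?_
    show _ ↔ _ ∧ _ ∧ _ = (-1 : SignType)
    rw [sign_eq_neg_one_iff]
  · refine hpos.congr fun p => ?_
    show _ ↔ _ ∧ _ ∧ _ = (1 : SignType)
    rw [sign_eq_one_iff]

/-- A set is regular if it is a union of cells of an arrangement of finitely many lines with
coefficients in the grid, that is, if membership of a point depends only on the signs of finitely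
many affine functions. -/
theorem isRegularSet_trace_of_sign {ι : Type*} [Finite ι] {f : ι → ℝ × ℝ → ℝ}
    (hf : ∀ i, G.IsAffine (f i)) {P : Set (ℝ × ℝ)}
    (hP : ∀ p q, (∀ i, SignType.sign (f i p) = SignType.sign (f i q)) → p ∈ P → q ∈ P) :
    IsRegularSet (G.trace P) := by
  rw [isRegularSet_trace_iff]
  have h1 : ∀ σ : ι → SignType, Recognizable fun p : Word S × Word S =>
      (∃ q ∈ P, ∀ i, SignType.sign (f i q) = σ i) ∧ ∀ i, p.1 ∈ G.words ∧ p.2 ∈ G.words ∧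
        SignType.sign (f i (G.val p.1, G.val p.2)) = σ i := fun σ =>
    (Recognizable.const _).and (Recognizable.forall_fintype fun i =>
      G.recognizable_sign_eq (hf i) (σ i))
  refine ((G.recognizable_mem_words Letterwise.fst).and
    ((G.recognizable_mem_words Letterwise.snd).and
      (Recognizable.exists_fintype h1))).congr fun p => ?_
  refine and_congr_right fun hp1 => and_congr_right fun hp2 => ⟨?_, fun h => ?_⟩
  · rintro ⟨σ, ⟨q, hq, hσ⟩, h⟩
    exact hP q _ (fun i => (hσ i).trans (h i).2.2.symm) hq
  · exact ⟨fun i => SignType.sign (f i (G.val p.1, G.val p.2)), ⟨_, h, fun _ => rfl⟩,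
      fun i => ⟨hp1, hp2, rfl⟩⟩

end SemiautomaticGrid

/-! ### Segments, triangles and polygons as unions of cells -/

/-- The signed area of the parallelogram spanned by `q - p` and `z - p`. -/
def signedArea (p q z : ℝ × ℝ) : ℝ := (q.1 - p.1) * (z.2 - p.2) - (q.2 - p.2) * (z.1 - p.1)

theorem mem_segment_iff_signedArea {p q z : ℝ × ℝ} : z ∈ segment ℝ p q ↔
    signedArea p q z = 0 ∧ (z.1 - p.1) * (z.1 - q.1) ≤ 0 ∧ (z.2 - p.2) * (z.2 - q.2) ≤ 0 := by
  obtain ⟨p₁, p₂⟩ := p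
  obtain ⟨q₁, q₂⟩ := q
  obtain ⟨z₁, z₂⟩ := z
  simp only [signedArea, segment_eq_image_lineMap, Set.mem_image, Set.mem_Icc,
    AffineMap.lineMap_apply_module, Prod.smul_mk, Prod.mk_add_mk, Prod.mk.injEq, smul_eq_mul]
  constructor
  · rintro ⟨t, ⟨h0, h1⟩, rfl, rfl⟩
    have ht : t * (t - 1) ≤ 0 := mul_nonpos_of_nonneg_of_nonpos h0 (by linarith)
    refine ⟨by ring, ?_, ?_⟩
    · have : ((1 - t) * p₁ + t * q₁ - p₁) * ((1 - t) * p₁ + t * q₁ - q₁) =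
        t * (t - 1) * (q₁ - p₁) ^ 2 := by ring
      rw [this]
      exact mul_nonpos_of_nonpos_of_nonneg ht (sq_nonneg _)
    · have : ((1 - t) * p₂ + t * q₂ - p₂) * ((1 - t) * p₂ + t * q₂ - q₂) =
        t * (t - 1) * (q₂ - p₂) ^ 2 := by ring
      rw [this]
      exact mul_nonpos_of_nonpos_of_nonneg ht (sq_nonneg _)
  · rintro ⟨h, hx, hy⟩
    have key : ∀ a b c : ℝ, a ≠ b → (c - a) * (c - b) ≤ 0 →
        0 ≤ (c - a) / (b - a) ∧ (c - a) / (b - a) ≤ 1 := by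
      intro a b c hab hc
      have hpos : 0 < (b - a) ^ 2 := by
        have : b - a ≠ 0 := sub_ne_zero.2 hab.symm
        positivity
      have e : (c - a) / (b - a) = (c - a) * (b - a) / (b - a) ^ 2 := by
        have : b - a ≠ 0 := sub_ne_zero.2 hab.symm
        field_simp
      rw [e]
      constructor
      · refine div_nonneg ?_ hpos.le
        nlinarith [sq_nonneg (c - a)]
      · rw [div_le_one hpos]
        nlinarith [sq_nonneg (c - b)]
    by_cases h1 : p₁ = q₁
    · subst h1
      by_cases h2 : p₂ = q₂
      · subst h2
        refine ⟨0, ⟨le_rfl, zero_le_one⟩, ?_, ?_⟩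
        · have : (z₁ - p₁) ^ 2 = 0 := le_antisymm (by linarith [sq (z₁ - p₁)]) (sq_nonneg _)
          have := pow_eq_zero_iff (two_ne_zero) |>.1 this
          linarith
        · have : (z₂ - p₂) ^ 2 = 0 := le_antisymm (by linarith [sq (z₂ - p₂)]) (sq_nonneg _)
          have := pow_eq_zero_iff (two_ne_zero) |>.1 this
          linarith
      · have hne : q₂ - p₂ ≠ 0 := sub_ne_zero.2 (Ne.symm h2)
        refine ⟨(z₂ - p₂) / (q₂ - p₂), key _ _ _ h2 hy, ?_, ?_⟩
        · have : (q₂ - p₂) * (z₁ - p₁) = 0 := by linarith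
          rcases mul_eq_zero.1 this with h | h
          · exact absurd h hne
          · linarith
        · field_simp
          ring
    · have hne : q₁ - p₁ ≠ 0 := sub_ne_zero.2 (Ne.symm h1)
      refine ⟨(z₁ - p₁) / (q₁ - p₁), key _ _ _ h1 hx, ?_, ?_⟩
      · field_simp
        ring
      · field_simp
        linarith

theorem affineIndependent_iff_signedArea_ne_zero {p q r : ℝ × ℝ} :
    AffineIndependent ℝ ![p, q, r] ↔ signedArea p q r ≠ 0 := by
  rw [affineIndependent_iff_not_collinear_set, not_iff_not,
    collinear_iff_of_mem (p₀ := p) (by simp)]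
  simp only [Set.mem_insert_iff, Set.mem_singleton_iff, forall_eq_or_imp, forall_eq,
    vadd_eq_add]
  constructor
  · rintro ⟨v, -, ⟨s, rfl⟩, ⟨t, rfl⟩⟩
    simp only [signedArea, Prod.fst_add, Prod.snd_add, Prod.smul_fst, Prod.smul_snd, smul_eq_mul]
    ring
  · intro h
    simp only [signedArea] at h
    by_cases h1 : q.1 - p.1 = 0
    · by_cases h2 : q.2 - p.2 = 0
      · refine ⟨r - p, ⟨0, by simp⟩, ⟨0, ?_⟩, ⟨1, by simp⟩⟩
        refine Prod.ext ?_ ?_ <;> simp <;> linarith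
      · refine ⟨q - p, ⟨0, by simp⟩, ⟨1, by simp⟩, ⟨(r.2 - p.2) / (q.2 - p.2), ?_⟩⟩
        refine Prod.ext ?_ ?_
        · simp
          field_simp
          linarith
        · simp
          field_simp
          ring
    · refine ⟨q - p, ⟨0, by simp⟩, ⟨1, by simp⟩, ⟨(r.1 - p.1) / (q.1 - p.1), ?_⟩⟩
      refine Prod.ext ?_ ?_
      · simp
        field_simp
        ring
      · simp
        field_simp
        linarith

theorem mem_convexHull_triple_iff {p q r z : ℝ × ℝ} (h : signedArea p q r ≠ 0) :
    z ∈ convexHull ℝ {p, q, r} ↔ 0 ≤ signedArea p q r * signedArea q r z ∧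
      0 ≤ signedArea p q r * signedArea r p z ∧ 0 ≤ signedArea p q r * signedArea p q z := by
  have hsum : signedArea q r z + signedArea r p z + signedArea p q z = signedArea p q r := by
    simp only [signedArea]; ring
  have haff : ∀ (u v x y : ℝ × ℝ) (s t : ℝ), s + t = 1 →
      signedArea u v (s • x + t • y) = s * signedArea u v x + t * signedArea u v y := by
    intro u v x y s t hst
    simp only [signedArea, Prod.fst_add, Prod.snd_add, Prod.smul_fst, Prod.smul_snd, smul_eq_mul]
    obtain rfl : s = 1 - t := by linarith
    ring
  constructor
  · have hconv : ∀ u v : ℝ × ℝ, Convex ℝ {x | 0 ≤ signedArea p q r * signedArea u v x} := by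
      intro u v x hx y hy s t hs ht hst
      have hx' : 0 ≤ signedArea p q r * signedArea u v x := hx
      have hy' : 0 ≤ signedArea p q r * signedArea u v y := hy
      show 0 ≤ signedArea p q r * signedArea u v (s • x + t • y)
      rw [haff u v x y s t hst]
      have := mul_nonneg hs hx'
      have := mul_nonneg ht hy'
      linarith
    intro hz
    refine convexHull_min (t := {x | 0 ≤ signedArea p q r * signedArea q r x} ∩
      ({x | 0 ≤ signedArea p q r * signedArea r p x} ∩
        {x | 0 ≤ signedArea p q r * signedArea p q x})) ?_
      ((hconv q r).inter ((hconv r p).inter (hconv p q))) hz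
    have e0 : ∀ u v : ℝ × ℝ, signedArea u v u = 0 ∧ signedArea u v v = 0 := fun u v => by
      simp only [signedArea]; constructor <;> ring
    have e1 : signedArea q r p = signedArea p q r := by simp only [signedArea]; ring
    have e2 : signedArea r p q = signedArea p q r := by simp only [signedArea]; ring
    have hsq := mul_self_nonneg (signedArea p q r)
    rintro x (rfl | rfl | rfl) <;>
      simp only [Set.mem_inter_iff, Set.mem_ofPred_eq, e0, e1, e2, mul_zero, le_refl, hsq, and_self]
  · rintro ⟨h1, h2, h3⟩
    -- the barycentric coordinates of `z` are quotients of signed areas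
    have hb : ∀ a, 0 ≤ signedArea p q r * a → 0 ≤ a / signedArea p q r := fun a ha => by
      rw [← mul_div_mul_left a (signedArea p q r) h]
      exact div_nonneg ha (mul_self_nonneg _)
    refine mem_convexHull_of_exists_fintype
      ![signedArea q r z / signedArea p q r, signedArea r p z / signedArea p q r,
        signedArea p q z / signedArea p q r] ![p, q, r] ?_ ?_ ?_ ?_
    · intro i
      fin_cases i
      exacts [hb _ h1, hb _ h2, hb _ h3]
    · simp only [Fin.sum_univ_three, Matrix.cons_val]
      rw [← add_div, ← add_div, hsum, div_self h]
    · intro i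
      fin_cases i <;> simp
    · simp only [Fin.sum_univ_three, Matrix.cons_val]
      refine Prod.ext ?_ ?_ <;>
      · simp only [Prod.fst_add, Prod.snd_add, Prod.smul_fst, Prod.smul_snd, smul_eq_mul]
        field_simp
        simp only [signedArea]
        ring

theorem triangleRegion_eq (T : Affine.Triangle ℝ (ℝ × ℝ)) :
    triangleRegion T = convexHull ℝ {T.points 0, T.points 1, T.points 2} := by
  have : Set.range T.points = {T.points 0, T.points 1, T.points 2} := by
    ext x
    simp [Fin.exists_fin_succ, eq_comm]
  rw [triangleRegion, this]

theorem signedArea_triangle_ne_zero (T : Affine.Triangle ℝ (ℝ × ℝ)) :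
    signedArea (T.points 0) (T.points 1) (T.points 2) ≠ 0 := by
  rw [← affineIndependent_iff_signedArea_ne_zero]
  convert T.independent using 1
  ext i <;> fin_cases i <;> rfl

/-- Two points with `f`-values of the same sign span a segment on which `f` keeps this sign. -/
theorem sign_affine_combination {f : ℝ × ℝ → ℝ} {a b c : ℝ}
    (hf : ∀ p, f p = a * p.1 + b * p.2 + c) {x y z : ℝ × ℝ}
    (h : SignType.sign (f x) = SignType.sign (f y)) (hz : z ∈ segment ℝ x y) :
    SignType.sign (f z) = SignType.sign (f x) := by
  obtain ⟨s, t, hs, ht, hst, rfl⟩ := hz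
  have e : f (s • x + t • y) = s * f x + t * f y := by
    simp only [hf, Prod.fst_add, Prod.snd_add, Prod.smul_fst, Prod.smul_snd, smul_eq_mul]
    linear_combination -c * hst
  rw [e]
  rcases lt_trichotomy (f x) 0 with hx | hx | hx
  · have hy : f y < 0 := by rwa [sign_neg hx, eq_comm, sign_eq_neg_one_iff] at h
    rw [sign_neg hx, sign_eq_neg_one_iff]
    rcases hs.eq_or_lt with rfl | hs
    · obtain rfl : t = 1 := by linarith
      linarith
    · nlinarith [mul_pos hs (neg_pos.2 hx), mul_nonneg ht (neg_pos.2 hy).le]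
  · have hy : f y = 0 := by rwa [hx, sign_zero, eq_comm, sign_eq_zero_iff] at h
    rw [hx, hy]; simp
  · have hy : 0 < f y := by rwa [sign_pos hx, eq_comm, sign_eq_one_iff] at h
    rw [sign_pos hx, sign_eq_one_iff]
    rcases hs.eq_or_lt with rfl | hs
    · obtain rfl : t = 1 := by linarith
      linarith
    · nlinarith [mul_pos hs hx, mul_nonneg ht hy.le]

theorem nonneg_mul_of_sign_eq {a b c : ℝ} (h : SignType.sign b = SignType.sign c)
    (hab : 0 ≤ a * b) : 0 ≤ a * c := by
  rw [← sign_nonneg_iff, sign_mul] at hab ⊢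
  rwa [← h]

theorem mul_nonpos_of_sign_eq {a b c d : ℝ} (h : SignType.sign a = SignType.sign c)
    (h' : SignType.sign b = SignType.sign d) (hab : a * b ≤ 0) : c * d ≤ 0 := by
  rw [← sign_nonpos_iff, sign_mul] at hab ⊢
  rwa [← h, ← h']

namespace SemiautomaticGrid

variable {S : Type*} (G : SemiautomaticGrid S)

theorem isAffine_signedArea {p q : ℝ × ℝ} (hp : p ∈ G.plane) (hq : q ∈ G.plane) :
    G.IsAffine (signedArea p q) := by
  have h1 := sub_mem hq.1 hp.1
  have h2 := sub_mem hq.2 hp.2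
  exact ⟨_, neg_mem h2, _, h1, _, sub_mem (mul_mem h2 hp.1) (mul_mem h1 hp.2), fun z => by
    simp only [signedArea]; ring⟩

theorem isAffine_fst_sub {p : ℝ × ℝ} (hp : p ∈ G.plane) : G.IsAffine fun z => z.1 - p.1 :=
  ⟨1, one_mem _, 0, zero_mem _, _, neg_mem hp.1, fun z => by ring⟩

theorem isAffine_snd_sub {p : ℝ × ℝ} (hp : p ∈ G.plane) : G.IsAffine fun z => z.2 - p.2 :=
  ⟨0, zero_mem _, 1, one_mem _, _, neg_mem hp.2, fun z => by ring⟩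

theorem isRegularSet_triangle [Finite S] (T : Affine.Triangle ℝ (ℝ × ℝ))
    (hT : ∀ i, T.points i ∈ G.plane) : IsRegularSet (G.trace (triangleRegion T)) := by
  refine G.isRegularSet_trace_of_sign
    (f := fun i : Fin 3 => signedArea (T.points (i + 1)) (T.points (i + 2)))
    (fun i => G.isAffine_signedArea (hT _) (hT _)) fun p q h hp => ?_
  have hD := signedArea_triangle_ne_zero T
  rw [triangleRegion_eq, mem_convexHull_triple_iff hD] at hp ⊢
  exact ⟨nonneg_mul_of_sign_eq (h 0) hp.1, nonneg_mul_of_sign_eq (h 1) hp.2.1,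
    nonneg_mul_of_sign_eq (h 2) hp.2.2⟩

/-- The lines through the edges and the vertical and horizontal lines through the vertices cut the
plane into convex cells. The boundary is a union of cells, and a cell outside the boundary is
connected and therefore enclosed by the boundary either completely or not at all. -/
theorem isRegularSet_polygon [Finite S] {n : ℕ} (P : Polygon (ℝ × ℝ) n)
    (hP : ∀ i, P.vertices i ∈ G.plane) : IsRegularSet (G.trace (polygonRegion P)) := by
  let f : Fin n ⊕ Fin n ⊕ Fin n → ℝ × ℝ → ℝ := Sum.elim
    (fun i => signedArea (P.vertices i) (P.vertices (finRotate n i)))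
    (Sum.elim (fun i z => z.1 - (P.vertices i).1) (fun i z => z.2 - (P.vertices i).2))
  have hf : ∀ i, G.IsAffine (f i) := by
    rintro (i | i | i)
    · exact G.isAffine_signedArea (hP _) (hP _)
    · exact G.isAffine_fst_sub (hP _)
    · exact G.isAffine_snd_sub (hP _)
  have hboundary : ∀ p q, (∀ i, SignType.sign (f i p) = SignType.sign (f i q)) →
      p ∈ P.boundary ℝ → q ∈ P.boundary ℝ := by
    intro p q h hp
    obtain ⟨i, hi⟩ := Set.mem_iUnion.1 hp
    refine Set.mem_iUnion.2 ⟨i, ?_⟩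
    rw [Polygon.edgeSet, affineSegment_eq_segment, mem_segment_iff_signedArea] at hi ⊢
    refine ⟨?_, mul_nonpos_of_sign_eq (h (.inr (.inl i))) (h (.inr (.inl (finRotate n i)))) hi.2.1,
      mul_nonpos_of_sign_eq (h (.inr (.inr i))) (h (.inr (.inr (finRotate n i)))) hi.2.2⟩
    have := (h (.inl i)).symm
    rwa [show f (.inl i) p = 0 from hi.1, sign_zero, sign_eq_zero_iff] at this
  refine G.isRegularSet_trace_of_sign hf fun p q h hp => ?_
  rcases hp with hp | ⟨hp, hbd⟩
  · exact Or.inl (hboundary p q h hp)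
  · refine Or.inr ⟨fun hq => hp (hboundary q p (fun i => (h i).symm) hq), ?_⟩
    have hsub : segment ℝ p q ⊆ (P.boundary ℝ)ᶜ := fun z hz hzb =>
      hp (hboundary z p (fun i => by
        obtain ⟨a, -, b, -, c, -, hi⟩ := hf i
        exact sign_affine_combination hi (h i) hz) hzb)
    have hq : q ∈ connectedComponentIn (P.boundary ℝ)ᶜ p :=
      (convex_segment p q).isPreconnected.subset_connectedComponentIn
        (left_mem_segment ℝ p q) hsub (right_mem_segment ℝ p q)
    rwa [← connectedComponentIn_eq hq]

end SemiautomaticGrid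

/-! ### Families of triangles -/

/-- A quadratic recursion forces doubly exponential growth. -/
theorem not_sq_le_of_le_pow {c : ℕ → ℕ} {n₀ K A : ℕ} (h₀ : 2 ≤ c n₀)
    (hsq : ∀ n, c n ^ 2 ≤ c (n + K)) : ¬ ∀ n, c n ≤ A ^ (2 * n + 1) := by
  intro hA
  have hlow : ∀ j, 2 ^ 2 ^ j ≤ c (n₀ + j * K) := by
    intro j
    induction j with
    | zero => simpa using h₀
    | succ j ih =>
      calc 2 ^ 2 ^ (j + 1) = (2 ^ 2 ^ j) ^ 2 := by rw [← pow_mul, pow_succ]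
        _ ≤ c (n₀ + j * K) ^ 2 := Nat.pow_le_pow_left ih 2
        _ ≤ c (n₀ + j * K + K) := hsq _
        _ = c (n₀ + (j + 1) * K) := by congr 1; ring
  have hlin : ∀ j, 2 ^ j ≤ A * (2 * n₀ + 1) + 2 * A * K * j := by
    intro j
    have h1 : 2 ^ 2 ^ j ≤ 2 ^ (A * (2 * (n₀ + j * K) + 1)) :=
      calc 2 ^ 2 ^ j ≤ A ^ (2 * (n₀ + j * K) + 1) := (hlow j).trans (hA _)
        _ ≤ (2 ^ A) ^ (2 * (n₀ + j * K) + 1) := Nat.pow_le_pow_left Nat.lt_two_pow_self.le _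
        _ = _ := (pow_mul 2 A _).symm
    have h2 := (Nat.pow_le_pow_iff_right (by norm_num)).1 h1
    calc 2 ^ j ≤ _ := h2
      _ = _ := by ring
  generalize A * (2 * n₀ + 1) = B at hlin
  generalize 2 * A * K = B' at hlin
  have h := hlin (2 * (B + 2 * B'))
  have h1 : (B + 2 * B' + 1) ^ 2 ≤ 2 ^ (2 * (B + 2 * B')) := by
    rw [mul_comm 2 (B + 2 * B'), pow_mul]
    exact Nat.pow_le_pow_left Nat.lt_two_pow_self 2
  nlinarith

namespace SemiautomaticGrid

open WordLike

variable {S : Type u} (G : SemiautomaticGrid S)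

theorem exists_mem_ring_gt (M : ℝ) : ∃ q ∈ G.ring, M < q := by
  obtain ⟨q, hq, h, -⟩ := G.dense_ring M (M + 1) (by linarith)
  exact ⟨q, hq, h⟩

/-- For every finite set of numbers there are a slope `x` and a triangle in the grid whose upper
boundary is the line of slope `x` through the origin at all these numbers, and `x` is so large that
`(a, b) ↦ x * a + b` is injective on pairs of these numbers. -/
theorem exists_triangle_of_finset (V : Finset ℝ) :
    ∃ x ∈ G.ring, (∀ a ∈ V, ∀ a' ∈ V, ∀ b ∈ V, ∀ b' ∈ V, x * a + b = x * a' + b' →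
      a = a' ∧ b = b') ∧ ∃ T : Affine.Triangle ℝ (ℝ × ℝ), (∀ i, T.points i ∈ G.plane) ∧
        ∀ a ∈ V, (a, x * a) ∈ triangleRegion T ∧ ∀ y, (a, y) ∈ triangleRegion T → y ≤ x * a := by
  obtain ⟨M, hM⟩ := (((V ×ˢ V) ×ˢ (V ×ˢ V)).image
    fun p => (p.2.2 - p.2.1) / (p.1.1 - p.1.2)).bddAbove
  obtain ⟨x, hx, hMx⟩ := G.exists_mem_ring_gt M
  obtain ⟨M', hM'⟩ := (V.image fun a => |a|).bddAbove
  obtain ⟨N, hN, hMN⟩ := G.exists_mem_ring_gt (max M' 0)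
  have hN0 : 0 < N := (le_max_right _ _).trans_lt hMN
  refine ⟨x, hx, fun a ha a' ha' b hb b' hb' h => ?_, ?_⟩
  · by_cases haa : a = a'
    · subst haa
      exact ⟨rfl, by linarith⟩
    · have hne : a - a' ≠ 0 := sub_ne_zero.2 haa
      have hle : (b' - b) / (a - a') ≤ M := hM (by
        simp only [Finset.coe_image, Set.mem_image]
        exact ⟨((a, a'), (b, b')), by simp [ha, ha', hb, hb'], rfl⟩)
      have : (b' - b) / (a - a') = x := by
        rw [div_eq_iff hne]
        linarith
      linarith
  · have hD : signedArea (-N, -(x * N)) (N, x * N) (0, -1) ≠ 0 := by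
      have : signedArea (-N, -(x * N)) (N, x * N) (0, -1) = -(2 * N) := by
        simp only [signedArea]; ring
      rw [this]
      linarith
    have hxN := mul_mem hx hN
    refine ⟨⟨![(-N, -(x * N)), (N, x * N), (0, -1)], affineIndependent_iff_signedArea_ne_zero.2 hD⟩,
      ?_, fun a ha => ?_⟩
    · intro i
      fin_cases i
      exacts [⟨neg_mem hN, neg_mem hxN⟩, ⟨hN, hxN⟩, ⟨zero_mem _, neg_mem (one_mem _)⟩]
    · have haN : |a| ≤ N := ((hM' (by simpa using ⟨a, ha, rfl⟩)).trans (le_max_left _ _)).trans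
        hMN.le
      obtain ⟨h1, h2⟩ := abs_le.1 haN
      simp only [triangleRegion_eq, Matrix.cons_val]
      constructor
      · rw [mem_convexHull_triple_iff hD]
        simp only [signedArea]
        refine ⟨?_, ?_, ?_⟩ <;> nlinarith
      · intro y hy
        rw [mem_convexHull_triple_iff hD] at hy
        have := hy.2.2
        simp only [signedArea] at this
        nlinarith [mul_pos hN0 hN0]

/-- The numbers that are represented by a word in the window `-n, …, n`. -/
def windowValues (n : ℕ) : Set ℝ := {a | ∃ w ∈ G.words,
  (∀ k : ℤ, w.symbol k ≠ none → -(n : ℤ) ≤ k ∧ k ≤ n) ∧ G.val w = a}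

theorem windowValues_finite_and_ncard_le [Finite S] (n : ℕ) :
    (G.windowValues n).Finite ∧ (G.windowValues n).ncard ≤ Nat.card (Option S) ^ (2 * n + 1) := by
  classical
  have := Fintype.ofFinite S
  let F : (Fin (2 * n + 1) → Option S) → ℝ := fun f => G.val
    ⟨fun k => if h : 0 ≤ k + n ∧ (k + n).toNat < 2 * n + 1 then f ⟨(k + n).toNat, h.2⟩ else none,
      (Set.finite_Icc (-(n : ℤ)) n).subset fun k hk => by
        by_contra h
        refine hk (dif_neg fun h' => h ?_)
        simp only [Set.mem_Icc]
        omega⟩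
  have hsub : G.windowValues n ⊆ Set.range F := by
    rintro _ ⟨w, -, hw, rfl⟩
    refine ⟨fun i => w.symbol ((i : ℤ) - n), congrArg G.val ?_⟩
    refine symb_injective (funext fun k => ?_)
    show (if h : 0 ≤ k + n ∧ (k + n).toNat < 2 * n + 1 then
      w.symbol (((k + n).toNat : ℤ) - n) else none) = w.symbol k
    split_ifs with h
    · congr 1
      omega
    · by_contra hne
      have := hw k (Ne.symm hne)
      omega
  refine ⟨(Set.finite_range F).subset hsub, ?_⟩
  calc (G.windowValues n).ncard ≤ (Set.range F).ncard :=
        Set.ncard_le_ncard hsub (Set.finite_range F)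
    _ ≤ Nat.card (Fin (2 * n + 1) → Option S) := by
        rw [← Set.image_univ, ← Set.ncard_univ]
        exact Set.ncard_image_le
    _ = _ := by simp

section Family

variable {I : Type v} (D : Set (Word I)) (L : Word I → Set (Word (Option S × Option S)))

/-- The point represented by `x` and `y` is the highest grid point of `L d` above `x`. -/
def IsTop (d : Word I) (x y : Word S) : Prop :=
  d ∈ D ∧ x ∈ G.words ∧ y ∈ G.words ∧ Word.conv x y ∈ L d ∧
    ∀ y', ¬ ((y ∈ G.words ∧ y' ∈ G.words ∧ G.val y < G.val y') ∧ d ∈ D ∧ Word.conv x y' ∈ L d)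

/-- The domain of `x` is contained in that of `e`. -/
def Within (e : Word Unit) (x : Word S) : Prop := ∀ k, x.symbol k ≠ none → e.symbol k ≠ none

/-- The upper boundary of `L d` is defined at all numbers represented by words on the positions
in `e`, and its translates by such numbers distinguish all pairs of such numbers. -/
def Separates (e : Word Unit) (d : Word I) : Prop :=
  (∀ a, a ∈ G.words ∧ Within e a → ∃ y, G.IsTop D L d a y) ∧
  ∀ a a' b b' y y' z, (Within e a ∧ Within e a' ∧ Within e b ∧ Within e b') ∧
    G.IsTop D L d a y ∧ G.IsTop D L d a' y' ∧
    (y ∈ G.words ∧ b ∈ G.words ∧ z ∈ G.words ∧ G.val y + G.val b = G.val z) ∧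
    (y' ∈ G.words ∧ b' ∈ G.words ∧ z ∈ G.words ∧ G.val y' + G.val b' = G.val z) →
    (a ∈ G.words ∧ a' ∈ G.words ∧ G.val a = G.val a') ∧
      (b ∈ G.words ∧ b' ∈ G.words ∧ G.val b = G.val b')

variable [Finite S] {X : Type w} [WordLike X]

theorem recognizable_within {f : X → Word Unit} {g : X → Word S} (hf : Letterwise f)
    (hg : Letterwise g) : Recognizable fun x => Within (f x) (g x) := by
  have : Recognizable fun p : Word Unit × Word S => Within p.1 p.2 :=
    Recognizable.of_pointwise (X := Word Unit × Word S)
      (fun l : Option Unit × Option S => l.2 ≠ none → l.1 ≠ none) fun h => absurd rfl h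
  exact this.comp₂ hf hg

variable {D L}

section Recognizable

variable [Finite I]

theorem recognizable_isTop (h : IsAutomaticFamily D L) {f : X → Word I} {g g' : X → Word S}
    (hf : Letterwise f) (hg : Letterwise g) (hg' : Letterwise g') :
    Recognizable fun x => G.IsTop D L (f x) (g x) (g' x) := by
  have hD : Recognizable fun d : Word I => d ∈ D := isRegularSet_iff_recognizable.1 h.1
  have hL := isAutomaticRel₂_iff_recognizable.1 h.2
  have hmem : Recognizable fun p : (Word I × Word S) × Word S =>
      p.1.1 ∈ D ∧ Word.conv p.1.2 p.2 ∈ L p.1.1 :=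
    hL.comp (g := fun p : (Word I × Word S) × Word S => (p.1.1, Word.conv p.1.2 p.2))
      ((Letterwise.fst.comp Letterwise.fst).prodMk (letterwise_conv.comp
        ((Letterwise.snd.comp Letterwise.fst).prodMk Letterwise.snd)))
  have key : Recognizable fun p : (Word I × Word S) × Word S => G.IsTop D L p.1.1 p.1.2 p.2 := by
    have hmax : Recognizable fun p : (Word I × Word S) × Word S =>
        ∀ y', ¬ ((p.2 ∈ G.words ∧ y' ∈ G.words ∧ G.val p.2 < G.val y') ∧
          p.1.1 ∈ D ∧ Word.conv p.1.2 y' ∈ L p.1.1) :=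
      .forall <| .not <| (G.recognizable_lt (by fun_prop) (by fun_prop)).and
        (hmem.comp (g := fun q : ((Word I × Word S) × Word S) × Word S => (q.1.1, q.2))
          (by fun_prop))
    have hwords : Recognizable fun p : (Word I × Word S) × Word S =>
        p.1.2 ∈ G.words ∧ p.2 ∈ G.words :=
      (G.recognizable_mem_words (by fun_prop)).and (G.recognizable_mem_words (by fun_prop))
    refine ((hmem.and hwords).and hmax).congr fun p => ?_
    unfold IsTop
    tauto
  exact key.comp ((hf.prodMk hg).prodMk hg')

theorem recognizable_separates (h : IsAutomaticFamily D L) :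
    Recognizable fun p : Word Unit × Word I => G.Separates D L p.1 p.2 := by
  unfold Separates
  refine .and ?_ ?_
  · refine .forall <| .imp (.and ?_ ?_) <| .exists ?_
    · exact G.recognizable_mem_words (by fun_prop)
    · exact recognizable_within (by fun_prop) (by fun_prop)
    · exact G.recognizable_isTop h (by fun_prop) (by fun_prop) (by fun_prop)
  · refine .forall <| .forall <| .forall <| .forall <| .forall <| .forall <| .forall <|
      .imp (.and (.and ?_ <| .and ?_ <| .and ?_ ?_) <| .and ?_ <| .and ?_ <| .and ?_ ?_) <|
        .and ?_ ?_
    · exact recognizable_within (by fun_prop) (by fun_prop)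
    · exact recognizable_within (by fun_prop) (by fun_prop)
    · exact recognizable_within (by fun_prop) (by fun_prop)
    · exact recognizable_within (by fun_prop) (by fun_prop)
    · exact G.recognizable_isTop h (by fun_prop) (by fun_prop) (by fun_prop)
    · exact G.recognizable_isTop h (by fun_prop) (by fun_prop) (by fun_prop)
    · exact G.recognizable_add (by fun_prop) (by fun_prop) (by fun_prop)
    · exact G.recognizable_add (by fun_prop) (by fun_prop) (by fun_prop)
    · exact G.recognizable_eq (by fun_prop) (by fun_prop)
    · exact G.recognizable_eq (by fun_prop) (by fun_prop)

end Recognizable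

/-- A triangle with a steep and long upper edge separates. -/
theorem exists_separates (hT : ∀ T : Affine.Triangle ℝ (ℝ × ℝ), (∀ i, T.points i ∈ G.plane) →
    ∃ d ∈ D, L d = G.trace (triangleRegion T)) (e : Word Unit) :
    ∃ d, G.Separates D L e d := by
  obtain ⟨n, hn⟩ := exists_fitsIn e
  have hfin := (G.windowValues_finite_and_ncard_le n).1
  have hV : ∀ w ∈ G.words, Within e w → G.val w ∈ hfin.toFinset := fun w hw h =>
    hfin.mem_toFinset.2 ⟨w, hw, fun k hk => hn k (h k hk), rfl⟩
  obtain ⟨x, hx, hsep, T, hTG, htop⟩ := G.exists_triangle_of_finset hfin.toFinset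
  obtain ⟨d, hd, hL⟩ := hT T hTG
  have key : ∀ a y, Within e a → (G.IsTop D L d a y ↔
      a ∈ G.words ∧ y ∈ G.words ∧ G.val y = x * G.val a) := by
    intro a y ha
    unfold IsTop
    simp only [hL, conv_mem_trace_iff]
    constructor
    · rintro ⟨-, haw, hyw, ⟨-, -, hy⟩, hmax⟩
      refine ⟨haw, hyw, ((htop _ (hV a haw ha)).2 _ hy).antisymm (not_lt.1 fun hlt => ?_)⟩
      obtain ⟨y', hy'w, hy'⟩ := G.exists_word (mul_mem hx (G.val_mem haw))
      refine hmax y' ⟨⟨hyw, hy'w, hy' ▸ hlt⟩, hd, haw, hy'w, ?_⟩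
      rw [hy']
      exact (htop _ (hV a haw ha)).1
    · rintro ⟨haw, hyw, hy⟩
      refine ⟨hd, haw, hyw, ⟨haw, hyw, ?_⟩, fun y' h => ?_⟩
      · rw [hy]
        exact (htop _ (hV a haw ha)).1
      · have := (htop _ (hV a haw ha)).2 _ h.2.2.2.2
        linarith [h.1.2.2]
  refine ⟨d, fun a ⟨haw, ha⟩ => ?_, ?_⟩
  · obtain ⟨y, hyw, hy⟩ := G.exists_word (mul_mem hx (G.val_mem haw))
    exact ⟨y, (key a y ha).2 ⟨haw, hyw, hy⟩⟩
  · rintro a a' b b' y y' z ⟨⟨ha, ha', hb, hb'⟩, h1, h2, ⟨-, hbw, -, h3⟩, -, hbw', -, h4⟩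
    obtain ⟨haw, -, hy⟩ := (key a y ha).1 h1
    obtain ⟨haw', -, hy'⟩ := (key a' y' ha').1 h2
    obtain ⟨h5, h6⟩ := hsep _ (hV a haw ha) _ (hV a' haw' ha') _ (hV b hbw hb) _ (hV b' hbw' hb')
      (by rw [← hy, ← hy', h3, h4])
    exact ⟨⟨haw, haw', h5⟩, hbw, hbw', h6⟩

/-- If `L d` separates the words in a window, then `(a, b) ↦ f(a) + b`, with `f` the upper boundary
of `L d`, is injective on pairs of numbers with words in this window. The index `d` and the sum can
be chosen with words that are only boundedly longer. -/
theorem exists_windowValues_ncard_sq_le [Finite I] (h : IsAutomaticFamily D L)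
    (hsep : ∀ e, ∃ d, G.Separates D L e d) :
    ∃ K, ∀ n, (G.windowValues n).ncard ^ 2 ≤ (G.windowValues (n + K)).ncard := by
  obtain ⟨C₁, hC₁⟩ := (G.recognizable_separates h).exists_short_witness
  obtain ⟨C₂, hC₂⟩ := (G.recognizable_isTop (X := (Word I × Word S) × Word S) h
    (f := fun p => p.1.1) (g := fun p => p.1.2) (g' := fun p => p.2)
    (by fun_prop) (by fun_prop) (by fun_prop)).exists_short_witness
      (P := fun (p : Word I × Word S) y => G.IsTop D L p.1 p.2 y)
  obtain ⟨C₃, hC₃⟩ := (G.recognizable_add (X := (Word S × Word S) × Word S)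
    (f := fun p => p.1.1) (g := fun p => p.1.2) (h := fun p => p.2)
    (by fun_prop) (by fun_prop) (by fun_prop)).exists_short_witness
      (P := fun (p : Word S × Word S) z => p.1 ∈ G.words ∧ p.2 ∈ G.words ∧ z ∈ G.words ∧
        G.val p.1 + G.val p.2 = G.val z)
  refine ⟨C₁ + C₂ + C₃, fun n => ?_⟩
  let e : Word Unit := ⟨fun k => if -(n : ℤ) ≤ k ∧ k ≤ n then some () else none,
    (Set.finite_Icc (-(n : ℤ)) n).subset fun k hk => by
      by_contra h
      exact hk (if_neg h)⟩
  have he : ∀ k, e.symbol k ≠ none ↔ -(n : ℤ) ≤ k ∧ k ≤ n := fun k => by simp [e]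
  obtain ⟨d, ⟨hd1, hd2⟩, hdfit⟩ := hC₁ e n (fun k hk => (he k).1 hk) (hsep e)
  have hfin := fun m => (G.windowValues_finite_and_ncard_le m).1
  rw [Set.ncard_eq_toFinset_card _ (hfin n), Set.ncard_eq_toFinset_card _ (hfin _), sq,
    ← Finset.card_product]
  refine Finset.card_le_card_of_forall_subsingleton (fun p v => ∃ a b y z,
    (Within e a ∧ Within e b) ∧ G.IsTop D L d a y ∧
    (y ∈ G.words ∧ b ∈ G.words ∧ z ∈ G.words ∧ G.val y + G.val b = G.val z) ∧
    p = (G.val a, G.val b) ∧ v = G.val z) ?_ ?_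
  · rintro ⟨_, _⟩ hp
    simp only [Finset.mem_product, Set.Finite.mem_toFinset] at hp
    obtain ⟨⟨a, haw, ha, rfl⟩, b, hbw, hb, rfl⟩ := hp
    have hae : Within e a := fun k hk => (he k).2 (ha k hk)
    have hbe : Within e b := fun k hk => (he k).2 (hb k hk)
    have hafit : FitsIn a n n := ha
    have hbfit : FitsIn b n n := hb
    obtain ⟨y, hy, hyfit⟩ := hC₂ (d, a) (n + C₁)
      (fitsIn_prod.2 ⟨hdfit, hafit.mono (by omega) (by omega)⟩) (hd1 a ⟨haw, hae⟩)
    have hyw := hy.2.2.1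
    obtain ⟨z, hz, hzfit⟩ := hC₃ (y, b) (n + C₁ + C₂)
      (fitsIn_prod.2 ⟨hyfit, hbfit.mono (by omega) (by omega)⟩) (by
        obtain ⟨z, hz, hz'⟩ := G.exists_word (add_mem (G.val_mem hyw) (G.val_mem hbw))
        exact ⟨z, hyw, hbw, hz, hz'.symm⟩)
    refine ⟨G.val z, ?_, a, b, y, z, ⟨hae, hbe⟩, hy, hz, rfl, rfl⟩
    rw [Set.Finite.mem_toFinset]
    exact ⟨z, hz.2.2.1, hzfit.mono (by omega) (by omega), rfl⟩
  · rintro v - p ⟨-, a, b, y, z, ⟨ha, hb⟩, h1, h2, rfl, rfl⟩ q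
      ⟨-, a', b', y', z', ⟨ha', hb'⟩, h1', h2', rfl, hz⟩
    obtain ⟨⟨-, -, h3⟩, -, -, h4⟩ := hd2 a a' b b' y y' z ⟨⟨ha, ha', hb, hb'⟩, h1, h1', h2,
      h2'.1, h2'.2.1, h2.2.2.1, h2'.2.2.2.trans hz.symm⟩
    rw [h3, h4]

theorem exists_two_le_ncard_windowValues : ∃ n, 2 ≤ (G.windowValues n).ncard := by
  obtain ⟨w₀, hw₀, h₀⟩ := G.exists_word (zero_mem _)
  obtain ⟨w₁, hw₁, h₁⟩ := G.exists_word (one_mem _)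
  obtain ⟨n, hn⟩ := exists_fitsIn (w₀, w₁)
  refine ⟨n, ?_⟩
  rw [← Set.ncard_pair (zero_ne_one (α := ℝ))]
  refine Set.ncard_le_ncard ?_ (G.windowValues_finite_and_ncard_le n).1
  rintro _ (rfl | rfl)
  exacts [⟨w₀, hw₀, (fitsIn_prod.1 hn).1, h₀⟩, ⟨w₁, hw₁, (fitsIn_prod.1 hn).2, h₁⟩]

end Family

end SemiautomaticGrid

theorem mainTheorem4 {S : Type*} (G : SemiautomaticGrid S) :
    -- no automatic family consists of triangles and has all triangles with corners in `G × G`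
    (∀ {I : Type*} [Finite I] (D : Set (Word I)) (L : Word I → Set (Word (Option S × Option S))),
      (∀ d ∈ D, ∃ T : Affine.Triangle ℝ (ℝ × ℝ), L d = G.trace (triangleRegion T)) →
      (∀ T : Affine.Triangle ℝ (ℝ × ℝ), (∀ i, T.points i ∈ G.plane) →
        ∃ d ∈ D, L d = G.trace (triangleRegion T)) →
      ¬ IsAutomaticFamily D L) ∧
    -- every triangle with corners in `G × G` is regular
    (∀ T : Affine.Triangle ℝ (ℝ × ℝ), (∀ i, T.points i ∈ G.plane) →
      IsRegularSet (G.trace (triangleRegion T))) ∧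
    -- every polygon with corners in `G × G` is regular
    (∀ (n : ℕ) (P : Polygon (ℝ × ℝ) n), (∀ i, P.vertices i ∈ G.plane) →
      IsRegularSet (G.trace (polygonRegion P))) := by
  have := G.finite_alphabet
  refine ⟨fun D L _ hT h => ?_, G.isRegularSet_triangle, fun n => G.isRegularSet_polygon⟩
  obtain ⟨K, hK⟩ := G.exists_windowValues_ncard_sq_le h (G.exists_separates hT)
  obtain ⟨n₀, h₀⟩ := G.exists_two_le_ncard_windowValues
  exact not_sq_le_of_le_pow h₀ hK
    fun n => (G.windowValues_finite_and_ncard_le n).2
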